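/- Let $d\ge 1$. For $x\in\mathbb Z^d$ let $E^x$ denote expectation for the simple random walk $(S_k)_{k\ge 0}$ on $\mathbb Z^d$ started at $x$, and let $H(y):=\inf\{k\ge 0: S_k=y\}$ for $y\in\mathbb Z^d$. For $\omega\colon\mathbb Z^d\to[0,\infty)$ put $$e(x,y,\omega):=E^x\Bigl[\exp\Bigl\{-\sum_{k=0}^{H(y)-1}\omega(S_k)\Bigr\}\mathbf 1_{\{H(y)<\infty\}}\Bigr].$$ For $0\le r\le 1$ let $\mathbb E_r$ denote expectation when $(\omega(x))_{x\in\mathbb Z^d}$ are i.i.d. with $\omega(x)=0$ with probability $r$ and $\omega(x)=1$ with probability $1-r$, and let $b_r(x,y):=-\log\mathbb E_r[e(x,y,\omega)]$. For $0<r<1$ there is a unique norm $\beta_r$ on $\mathbb R^d$, the annealed Lyapunov exponent, such that $\lim_{n\to\infty}\frac1n b_r(0,nx)=\beta_r(x)$ for all $x\in\mathbb Z^d$. It satisfies the following. (1) For all $0<p<q<1$, $$\inf_{x\in\mathbb R^d\setminus\{0\}}\frac{\beta_p(x)-\beta_q(x)}{\|x\|_1}\ge(1-e^{-1})(q-p).$$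 (2) Let $0<q_0<1$. There is a constant $0<C<\infty$, depending only on $d$ and $q_0$, such that for all $0<p<q\le q_0$, $$\sup_{x\in\mathbb R^d\setminus\{0\}}\frac{\beta_p(x)-\beta_q(x)}{\|x\|_1}\le C(\log q-\log p).$$ If $d\ge 3$, then the right side can be replaced by $C(q-p)$. -/

import Mathlib

open MeasureTheory ProbabilityTheory Filter Topology
open scoped NNReal

noncomputable section

namespace BernoulliWalk

/-- The nearest-neighbour step in the lattice of dimension `d` along the coordinate direction
`s.1`, with positive sign if `s.2 = true` and negative sign otherwise. -/
def unitStep {d : ℕ} (s : Fin d × Bool) : Fin d → ℤ :=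
  Pi.single s.1 (if s.2 then 1 else -1)

/-- The law of the simple random walk `(S_k)` started at `x`, on the space of trajectories:
`S_k` is `x` plus the sum of `k` independent steps, each of them uniformly distributed among the
`2 * d` nearest-neighbour steps. -/
def walkLaw {d : ℕ} (x : Fin d → ℤ) : Measure (ℕ → Fin d → ℤ) :=
  (Measure.infinitePi fun _ : ℕ => uniformOn (Set.univ : Set (Fin d × Bool))).map
    fun ξ k => x + ∑ i ∈ Finset.range k, unitStep (ξ i)

/-- The hitting time `H(y)` of `y` by the trajectory `S`; it is `⊤` if `S` never visits `y`. -/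
def hittingTime {d : ℕ} (y : Fin d → ℤ) (S : ℕ → Fin d → ℤ) : ℕ∞ :=
  ⨅ (k : ℕ) (_ : S k = y), (k : ℕ∞)

/-- The quantity
`e(x, y, ω) = E^x [exp (- ∑_{0 ≤ k < H(y)} ω(S_k)) ; H(y) < ∞]`.
The sum is empty, and the value is `1`, if `x = y`. -/
def travelWeight {d : ℕ} (x y : Fin d → ℤ) (ω : (Fin d → ℤ) → ℝ≥0) : ℝ :=
  ∫ S, Set.indicator {S | hittingTime y S < ⊤}
    (fun S => Real.exp (-∑ k ∈ Finset.range (hittingTime y S).toNat, (ω (S k) : ℝ))) S ∂(walkLaw x)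

/-- The law of the Bernoulli potential with parameter `r`: the values at the sites are independent,
each of them equal to `0` with probability `r` and to `1` with probability `1 - r`. -/
def potentialLaw (d : ℕ) (r : unitInterval) : Measure ((Fin d → ℤ) → ℝ≥0) :=
  Measure.infinitePi fun _ : Fin d → ℤ => bernoulliMeasure (0 : ℝ≥0) 1 r

/-- The annealed travel cost `b_r(x, y) = - log E_r [e(x, y, ω)]`. -/
def annealedCost {d : ℕ} (r : unitInterval) (x y : Fin d → ℤ) : ℝ :=
  -Real.log (∫ ω, travelWeight x y ω ∂(potentialLaw d r))

/-- `β` is a norm on `ℝ^d` (a seminorm that vanishes only at `0`) such that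
`β(x) = lim_n b_r(0, n x) / n` for all lattice points `x`. -/
def IsAnnealedLyapunovExponent (d : ℕ) (r : unitInterval) (β : Seminorm ℝ (Fin d → ℝ)) : Prop :=
  (∀ x, β x = 0 → x = 0) ∧
  ∀ x : Fin d → ℤ,
    Tendsto (fun n : ℕ => annealedCost r 0 (n • x) / (n : ℝ)) atTop (𝓝 (β fun i => (x i : ℝ)))

/-- The annealed Lyapunov exponent `β_r`: the norm on `ℝ^d` that extends the limits
`lim_n b_r(0, n x) / n` from the lattice. -/
def annealedLyapunovExponent (d : ℕ) (r : unitInterval) : Seminorm ℝ (Fin d → ℝ) :=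
  Classical.epsilon (IsAnnealedLyapunovExponent d r)

/-- The `ℓ¹`-norm on `ℝ^d`. -/
def l1Norm {d : ℕ} (x : Fin d → ℝ) : ℝ := ∑ i, |x i|

end BernoulliWalk

end

/-! Write φ_r(k) = r + (1-r)e^{-k} (`siteFactor`). Averaging over the independent potential turns
E_r[e(0,y,ω)] into a sum Z_r(y) over first-passage paths to y (`passageWeight`,
`annealedCost_eq_passageCost`): each path carries its probability times the product of φ_r(number of
visits) over the sites it visits. All bounds compare such products.

Existence: φ_r(k)φ_r(l) ≤ φ_r(k+l) makes Z_r supermultiplicative (`passageWeight_mul_le`), so -log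
Z_r is subadditive. It lies between two positive multiples of |y|₁, and Fekete's lemma, applied to a
Lipschitz extension to ℝ^d, yields the norm (`exists_seminorm_tendsto`).

Lower bound: a path to y visits at least |y|₁ sites, and passing from p to q raises the factor of
each visited site by at least exp((1-e^{-1})(q-p)) (`passageWeight_exp_mul_le`).

Logarithmic upper bound: Z_q(y) ≥ c^{|y|₁} with c depending only on d, whereas paths visiting at
least K|y|₁ sites carry at most half of that, with K depending only on d and q₀. On the other paths
the weight changes by at most (q/p)^{K|y|₁} (`passageWeight_le_div_pow_mul_add`).

Linear upper bound for d ≥ 3: Z_q - Z_p is at most q-p times the sum over z of the q-weights of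
paths through z with the factor at z removed. Cutting out the loop between the first and the last
visit to z leaves a path that visits z once, where the factor can be restored at cost e. The
probabilities of the loops sum to at most a constant by transience (`tsum_puncturedWeight_le`).
Hence the relative rate of change of Z is at most a constant times the weighted mean number of
visited sites, which is O(|y|₁) (`tsum_card_le`). Integrating this rate from p to q finishes the
proof (`le_exp_mul_of_local_bound`). -/

noncomputable section

namespace BernoulliWalk

open scoped ENNReal

/-! ### Words of random letters and prefix-free families -/

section Words

variable {α : Type*} [Fintype α]

/-- The probability that a sequence of independent uniform letters starts with the word `l`. -/
def wordProb (l : List α) : ℝ≥0∞ := ((Fintype.card α : ℝ≥0∞)⁻¹) ^ l.length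

@[simp] theorem wordProb_nil : wordProb ([] : List α) = 1 := by simp [wordProb]

theorem wordProb_append (l l' : List α) : wordProb (l ++ l') = wordProb l * wordProb l' := by
  simp [wordProb, pow_add]

theorem wordProb_map {γ : Type*} [Fintype γ] (e : α ≃ γ) (l : List α) :
    wordProb (l.map e) = wordProb l := by
  simp [wordProb, Fintype.card_congr e]

/-- The word formed by the first `n` letters of a sequence. -/
def initialWord {α : Type*} (ξ : ℕ → α) (n : ℕ) : List α := (List.range n).map ξ

@[simp] theorem length_initialWord {α : Type*} (ξ : ℕ → α) (n : ℕ) :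
    (initialWord ξ n).length = n := by simp [initialWord]

theorem initialWord_succ {α : Type*} (ξ : ℕ → α) (n : ℕ) :
    initialWord ξ (n + 1) = initialWord ξ n ++ [ξ n] := by
  simp [initialWord, List.range_succ]

theorem initialWord_prefix {α : Type*} (ξ : ℕ → α) {m n : ℕ} (h : m ≤ n) :
    initialWord ξ m <+: initialWord ξ n := by
  induction n, h using Nat.le_induction with
  | base => exact List.prefix_rfl
  | succ n _ ih => exact ih.trans ⟨[ξ n], (initialWord_succ ξ n).symm⟩

/-- The set of sequences that start with the word `l`. -/
def wordCylinder {α : Type*} (l : List α) : Set (ℕ → α) := {ξ | initialWord ξ l.length = l}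

theorem wordCylinder_eq_pi {α : Type*} (l : List α) :
    wordCylinder l = Set.pi (Finset.range l.length : Set ℕ) fun i => {a | l[i]? = some a} := by
  ext ξ
  simp only [wordCylinder, initialWord, Set.mem_ofPred_eq, Set.mem_pi, Finset.coe_range, Set.mem_Iio]
  constructor
  · intro h i hi
    conv_lhs => rw [← h]
    simp [hi]
  · intro h
    apply List.ext_getElem (by simp)
    intro i h1 h2
    have := h i h2
    rw [List.getElem?_eq_getElem h2] at this
    simpa using this.symm

variable [MeasurableSpace α] [MeasurableSingletonClass α]

theorem measurableSet_wordCylinder (l : List α) : MeasurableSet (wordCylinder l) := by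
  rw [wordCylinder_eq_pi]
  exact MeasurableSet.pi (Finset.countable_toSet _) fun i _ => Set.Finite.measurableSet (Set.toFinite _)

theorem infinitePi_wordCylinder [Nonempty α] (l : List α) :
    Measure.infinitePi (fun _ : ℕ => uniformOn (Set.univ : Set α)) (wordCylinder l) =
      wordProb l := by
  rw [wordCylinder_eq_pi, Measure.infinitePi_pi _
    (fun i _ => Set.Finite.measurableSet (Set.toFinite _))]
  rw [wordProb, ← Finset.card_range l.length, ← Finset.prod_const, Finset.card_range]
  refine Finset.prod_congr rfl fun i hi => ?_
  rw [Finset.mem_range] at hi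
  have : {a | l[i]? = some a} = {l[i]} := by
    ext a; simp [List.getElem?_eq_getElem hi, eq_comm]
  rw [this, uniformOn_univ, Measure.count_singleton, one_div]

/-- **Kraft's inequality** for a prefix-free family of words. -/
theorem tsum_wordProb_le_one {α : Type*} [Fintype α] [Nonempty α] {ι : Type*} (a : ι → List α)
    (ha : ∀ i j, a i <+: a j → i = j) : ∑' i, wordProb (a i) ≤ 1 := by
  let _ : MeasurableSpace α := ⊤
  have : MeasurableSingletonClass α := ⟨fun _ => trivial⟩
  have hinj : Function.Injective a := fun i j h => ha i j (h ▸ List.prefix_rfl)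
  have : Countable ι := hinj.countable
  -- Two initial words of the same sequence are comparable as prefixes, so prefix-freeness makes the
  -- cylinders disjoint.
  have hdisj : Pairwise (Function.onFun Disjoint fun i => wordCylinder (a i)) := by
    intro i j hij
    refine Set.disjoint_left.2 fun ξ hi hj => hij ?_
    simp only [wordCylinder, Set.mem_ofPred_eq] at hi hj
    rcases le_total (a i).length (a j).length with h | h
    · exact ha i j (by simpa only [hi, hj] using initialWord_prefix ξ h)
    · exact (ha j i (by simpa only [hi, hj] using initialWord_prefix ξ h)).symm
  simp_rw [← infinitePi_wordCylinder]
  rw [← measure_iUnion hdisj fun i => measurableSet_wordCylinder _]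
  exact prob_le_one

end Words

/-- If every word of a prefix-free family has a prefix of larger value in another family, then
the expected value of the former is at most that of the latter. -/
theorem tsum_wordProb_mul_le_of_prefix {α : Type*} [Fintype α] [Nonempty α] {ι κ : Type*} (a : ι → List α)
    (b : κ → List α) (f : ι → ℝ≥0∞) (g : κ → ℝ≥0∞) (ha : ∀ i j, a i <+: a j → i = j)
    (h : ∀ i, ∃ j, b j <+: a i ∧ f i ≤ g j) :
    ∑' i, wordProb (a i) * f i ≤ ∑' j, wordProb (b j) * g j := by
  choose φ hφ hfg using h
  choose τ hτ using hφ
  calc ∑' i, wordProb (a i) * f i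
      ≤ ∑' i, wordProb (b (φ i)) * g (φ i) * wordProb (τ i) := by
        refine ENNReal.tsum_le_tsum fun i => ?_
        rw [← hτ i, wordProb_append, mul_right_comm]
        gcongr
        exact hfg i
    _ = ∑' j, ∑' i : {i // φ i = j}, wordProb (b (φ i)) * g (φ i) * wordProb (τ i) := by
        rw [← (Equiv.sigmaFiberEquiv φ).tsum_eq, ENNReal.tsum_sigma']
        rfl
    _ ≤ ∑' j, wordProb (b j) * g j := by
        refine ENNReal.tsum_le_tsum fun j => ?_
        calc ∑' i : {i // φ i = j}, wordProb (b (φ i)) * g (φ i) * wordProb (τ i)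
            = wordProb (b j) * g j * ∑' i : {i // φ i = j}, wordProb (τ i) := by
              rw [← ENNReal.tsum_mul_left]
              exact tsum_congr fun i => by rw [i.2]
          _ ≤ wordProb (b j) * g j * 1 := by
              gcongr
              -- Within a fibre of `φ` all words share the prefix `b j`, so the remainders `τ` are
              -- again prefix-free.
              refine tsum_wordProb_le_one _ fun i i' hii => Subtype.ext (ha _ _ ?_)
              rw [← hτ i, ← hτ i', i.2, i'.2]
              exact (List.prefix_append_right_inj _).2 hii
          _ = _ := mul_one _

/-! ### Lattice paths, first passages and the number of visited sites -/

section Paths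

variable {d : ℕ}

/-- The endpoint of the walk that starts at `x` and follows the steps of the word `l`. -/
def endpoint (x : Fin d → ℤ) : List (Fin d × Bool) → Fin d → ℤ
  | [] => x
  | s :: l => endpoint (x + unitStep s) l

/-- The sites that the walk started at `x` with steps `l` occupies before its final time, listed
with multiplicity in the order of the visits. -/
def sites (x : Fin d → ℤ) : List (Fin d × Bool) → List (Fin d → ℤ)
  | [] => []
  | s :: l => x :: sites (x + unitStep s) l

theorem endpoint_append (x : Fin d → ℤ) (l l' : List (Fin d × Bool)) :
    endpoint x (l ++ l') = endpoint (endpoint x l) l' := by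
  induction l generalizing x with
  | nil => rfl
  | cons s l ih => exact ih _

theorem sites_append (x : Fin d → ℤ) (l l' : List (Fin d × Bool)) :
    sites x (l ++ l') = sites x l ++ sites (endpoint x l) l' := by
  induction l generalizing x with
  | nil => rfl
  | cons s l ih => simp [sites, endpoint, ih]

theorem endpoint_add (x y : Fin d → ℤ) (l : List (Fin d × Bool)) :
    endpoint (x + y) l = x + endpoint y l := by
  induction l generalizing y with
  | nil => rfl
  | cons s l ih => simp only [endpoint, add_assoc, ih]

theorem sites_add (x y : Fin d → ℤ) (l : List (Fin d × Bool)) :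
    sites (x + y) l = (sites y l).map (x + ·) := by
  induction l generalizing y with
  | nil => rfl
  | cons s l ih => simp only [sites, List.map_cons, add_assoc, ih]

/-- The reversal of the direction of a step. -/
def flipStep (d : ℕ) : Fin d × Bool ≃ Fin d × Bool := Equiv.prodCongr (Equiv.refl _) Equiv.boolNot

theorem unitStep_flipStep (s : Fin d × Bool) : unitStep (flipStep d s) = -unitStep s := by
  rcases s with ⟨i, b⟩
  cases b <;> simp [unitStep, flipStep, ← Pi.single_neg]

theorem endpoint_map_flipStep (x : Fin d → ℤ) (l : List (Fin d × Bool)) :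
    endpoint (-x) (l.map (flipStep d)) = -endpoint x l := by
  induction l generalizing x with
  | nil => rfl
  | cons s l ih => rw [List.map_cons, endpoint, endpoint, ← ih, unitStep_flipStep, neg_add]

theorem sites_map_flipStep (x : Fin d → ℤ) (l : List (Fin d × Bool)) :
    sites (-x) (l.map (flipStep d)) = (sites x l).map Neg.neg := by
  induction l generalizing x with
  | nil => rfl
  | cons s l ih =>
    rw [List.map_cons, sites, sites, List.map_cons, ← ih, unitStep_flipStep, neg_add]

/-- A visited site splits the word at the first visit. -/
theorem exists_append_of_mem_sites {x z : Fin d → ℤ} {l : List (Fin d × Bool)}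
    (h : z ∈ sites x l) :
    ∃ l₁ l₂, l = l₁ ++ l₂ ∧ l₂ ≠ [] ∧ endpoint x l₁ = z ∧ z ∉ sites x l₁ := by
  induction l generalizing x with
  | nil => simp [sites] at h
  | cons s l ih =>
    by_cases hx : z = x
    · exact ⟨[], s :: l, rfl, by simp, hx.symm, by simp [sites]⟩
    · obtain ⟨l₁, l₂, rfl, h2, h3, h4⟩ := ih (List.mem_of_ne_of_mem hx h)
      exact ⟨s :: l₁, l₂, rfl, h2, h3, by simp [sites, hx, h4]⟩

/-- A visited site splits the word at the last visit. -/
theorem exists_append_last_of_mem_sites {x z : Fin d → ℤ} {l : List (Fin d × Bool)}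
    (h : z ∈ sites x l) :
    ∃ l₁ s l₂, l = l₁ ++ s :: l₂ ∧ endpoint x l₁ = z ∧ z ∉ sites (z + unitStep s) l₂ := by
  induction l generalizing x with
  | nil => simp [sites] at h
  | cons s l ih =>
    by_cases hl : z ∈ sites (x + unitStep s) l
    · obtain ⟨l₁, s', l₂, rfl, h2, h3⟩ := ih hl
      exact ⟨s :: l₁, s', l₂, rfl, h2, h3⟩
    · have hx : z = x := by simpa [sites, hl] using h
      subst hx
      exact ⟨[], s, l, rfl, rfl, hl⟩

/-- The word `l` leads from `x` to `y` and reaches `y` for the first time at its end. -/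
def IsFirstPassage (x y : Fin d → ℤ) (l : List (Fin d × Bool)) : Prop :=
  endpoint x l = y ∧ y ∉ sites x l

/-- A proper extension of a word ending at `y` makes a step from `y`, so `y` is among its sites.
This gives the prefix-freeness needed for Kraft's inequality and for unique decompositions. -/
theorem IsFirstPassage.eq_of_prefix {x y : Fin d → ℤ} {l l' : List (Fin d × Bool)}
    (h : IsFirstPassage x y l) (h' : IsFirstPassage x y l') (hl : l <+: l') : l = l' := by
  obtain ⟨t, rfl⟩ := hl
  cases t with
  | nil => simp
  | cons s t =>
    refine absurd ?_ h'.2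
    rw [sites_append, h.1]
    simp [sites]

theorem exists_prefix_isFirstPassage {x y : Fin d → ℤ} {l : List (Fin d × Bool)}
    (h : endpoint x l = y) : ∃ l₁, l₁ <+: l ∧ IsFirstPassage x y l₁ := by
  by_cases hy : y ∈ sites x l
  · obtain ⟨l₁, l₂, rfl, -, h3, h4⟩ := exists_append_of_mem_sites hy
    exact ⟨l₁, List.prefix_append _ _, h3, h4⟩
  · exact ⟨l, List.prefix_rfl, h, hy⟩

/-- The `ℓ¹`-norm of a lattice point, as a natural number. -/
def latticeNorm (x : Fin d → ℤ) : ℕ := ∑ i, (x i).natAbs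

theorem latticeNorm_add_le (x y : Fin d → ℤ) :
    latticeNorm (x + y) ≤ latticeNorm x + latticeNorm y := by
  rw [latticeNorm, latticeNorm, latticeNorm, ← Finset.sum_add_distrib]
  exact Finset.sum_le_sum fun i _ => Int.natAbs_add_le _ _

theorem latticeNorm_eq_zero {x : Fin d → ℤ} : latticeNorm x = 0 ↔ x = 0 := by
  simp [latticeNorm, Finset.sum_eq_zero_iff, funext_iff]

theorem latticeNorm_unitStep (s : Fin d × Bool) : latticeNorm (unitStep s) = 1 := by
  rcases s with ⟨i, b⟩
  rw [latticeNorm, Finset.sum_eq_single i]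
  · cases b <;> simp [unitStep]
  · intro j _ hj; simp [unitStep, Pi.single_eq_of_ne hj]
  · simp

theorem latticeNorm_nsmul (n : ℕ) (x : Fin d → ℤ) : latticeNorm (n • x) = n * latticeNorm x := by
  simp [latticeNorm, Finset.mul_sum, Int.natAbs_mul]

/-- Every nonzero lattice point has a neighbour closer to the origin. -/
theorem exists_latticeNorm_sub_unitStep {x : Fin d → ℤ} (hx : x ≠ 0) :
    ∃ s : Fin d × Bool, latticeNorm (x - unitStep s) + 1 = latticeNorm x := by
  obtain ⟨i, hi⟩ := Function.ne_iff.1 hx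
  rw [Pi.zero_apply] at hi
  refine ⟨(i, decide (0 < x i)), ?_⟩
  rw [latticeNorm, latticeNorm, ← Finset.add_sum_erase _ _ (Finset.mem_univ i),
    ← Finset.add_sum_erase Finset.univ (fun j => (x j).natAbs) (Finset.mem_univ i)]
  have : ∀ j ∈ Finset.univ.erase i,
      ((x - unitStep (i, decide (0 < x i))) j).natAbs = (x j).natAbs := by
    intro j hj
    simp [unitStep, Pi.single_eq_of_ne (Finset.ne_of_mem_erase hj)]
  rw [Finset.sum_congr rfl this]
  have h : ((x - unitStep (i, decide (0 < x i))) i).natAbs + 1 = (x i).natAbs := by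
    simp only [unitStep, Pi.sub_apply, Pi.single_eq_same, decide_eq_true_eq]
    split_ifs <;> omega
  omega

/-- A discrete intermediate value theorem: the distance to `y` drops by at most one per step. The
value `k = 0` is excluded because `sites` omits the final position. -/
theorem exists_mem_sites_latticeNorm {x y : Fin d → ℤ} {l : List (Fin d × Bool)}
    (h : endpoint x l = y) {k : ℕ} (hk : 0 < k) (hkx : k ≤ latticeNorm (y - x)) :
    ∃ z ∈ sites x l, latticeNorm (y - z) = k := by
  induction l generalizing x with
  | nil => simp_all [endpoint, latticeNorm]
  | cons s l ih =>
    rcases hkx.eq_or_lt with rfl | hlt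
    · exact ⟨x, by simp [sites], rfl⟩
    · have h1 := latticeNorm_add_le (y - (x + unitStep s)) (unitStep s)
      rw [latticeNorm_unitStep, show y - (x + unitStep s) + unitStep s = y - x by abel] at h1
      obtain ⟨z, hz, hz'⟩ := ih h (by omega)
      exact ⟨z, by simp [sites, hz], hz'⟩

/-- A path visits at least as many sites as the distance between its ends. -/
theorem latticeNorm_le_card_sites {x y : Fin d → ℤ} {l : List (Fin d × Bool)}
    (h : endpoint x l = y) : latticeNorm (y - x) ≤ (sites x l).toFinset.card := by
  calc latticeNorm (y - x) = (Finset.Icc 1 (latticeNorm (y - x))).card := by simp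
    _ ≤ ((sites x l).toFinset.image fun z => latticeNorm (y - z)).card := by
      refine Finset.card_le_card fun k hk => ?_
      rw [Finset.mem_Icc] at hk
      obtain ⟨z, hz, hz'⟩ := exists_mem_sites_latticeNorm h hk.1 hk.2
      exact Finset.mem_image.2 ⟨z, List.mem_toFinset.2 hz, hz'⟩
    _ ≤ _ := Finset.card_image_le

end Paths

/-! ### Averaged weights of visited sites and their dependence on the parameter -/

section Weights

/-- The expectation of `exp (-k ω)` for a potential value `ω` that is `0` with probability `r` and
`1` otherwise. -/
def siteFactor (r : ℝ) (k : ℕ) : ℝ := r + (1 - r) * Real.exp (-(k : ℝ))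

@[simp] theorem siteFactor_zero (r : ℝ) : siteFactor r 0 = 1 := by simp [siteFactor]

theorem exp_neg_natCast_le_one (k : ℕ) : Real.exp (-(k : ℝ)) ≤ 1 :=
  Real.exp_le_one_iff.2 (by simp)

theorem exp_neg_natCast_le {k : ℕ} (hk : k ≠ 0) : Real.exp (-(k : ℝ)) ≤ Real.exp (-1) := by
  have : (1 : ℝ) ≤ k := by exact_mod_cast Nat.one_le_iff_ne_zero.2 hk
  gcongr

theorem siteFactor_pos {r : ℝ} (hr0 : 0 ≤ r) (k : ℕ) : 0 < siteFactor r k := by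
  have := Real.exp_pos (-(k : ℝ))
  have := exp_neg_natCast_le_one k
  rw [siteFactor]
  nlinarith

theorem siteFactor_le_one {r : ℝ} (hr1 : r ≤ 1) (k : ℕ) : siteFactor r k ≤ 1 := by
  have := exp_neg_natCast_le_one k
  rw [siteFactor]
  nlinarith

theorem siteFactor_antitone {r : ℝ} (hr1 : r ≤ 1) : Antitone (siteFactor r) := by
  intro k l h
  rw [siteFactor, siteFactor]
  have : (k : ℝ) ≤ l := by exact_mod_cast h
  have : 0 ≤ 1 - r := by linarith
  gcongr

theorem siteFactor_mono_param {p q : ℝ} (hpq : p ≤ q) (k : ℕ) :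
    siteFactor p k ≤ siteFactor q k := by
  have := exp_neg_natCast_le_one k
  rw [siteFactor, siteFactor]
  nlinarith

/-- The difference of the two sides is r(1-r)(1-e^{-k})(1-e^{-l}). -/
theorem siteFactor_mul_le {r : ℝ} (hr0 : 0 ≤ r) (hr1 : r ≤ 1) (k l : ℕ) :
    siteFactor r k * siteFactor r l ≤ siteFactor r (k + l) := by
  have h1 := exp_neg_natCast_le_one k
  have h2 := exp_neg_natCast_le_one l
  have h3 : Real.exp (-((k + l : ℕ) : ℝ)) = Real.exp (-(k : ℝ)) * Real.exp (-(l : ℝ)) := by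
    rw [← Real.exp_add]; push_cast; ring_nf
  rw [siteFactor, siteFactor, siteFactor, h3]
  have h4 : 0 ≤ r * (1 - r) := mul_nonneg hr0 (by linarith)
  nlinarith [mul_nonneg h4 (mul_nonneg (sub_nonneg.2 h1) (sub_nonneg.2 h2))]

theorem siteFactor_le_of_ne_zero {r : ℝ} (hr1 : r ≤ 1) {k : ℕ} (hk : k ≠ 0) :
    siteFactor r k ≤ siteFactor r 1 :=
  siteFactor_antitone hr1 (Nat.one_le_iff_ne_zero.2 hk)

theorem siteFactor_one_lt_one {r : ℝ} (hr1 : r < 1) : siteFactor r 1 < 1 := by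
  have : Real.exp (-1) < 1 := Real.exp_lt_one_iff.2 (by norm_num)
  simp only [siteFactor, Nat.cast_one]
  nlinarith

theorem exp_neg_one_le_siteFactor_one {r : ℝ} (hr0 : 0 ≤ r) :
    Real.exp (-1) ≤ siteFactor r 1 := by
  have : Real.exp (-1) < 1 := Real.exp_lt_one_iff.2 (by norm_num)
  simp only [siteFactor, Nat.cast_one]
  nlinarith

/-- For c = (1-e^{-1})(q-p) and k ≥ 1, φ_q(k) - φ_p(k) = (q-p)(1-e^{-k}) ≥ c. Since φ_q(k) ≤ 1, this
gives φ_p(k) ≤ φ_q(k)(1-c) ≤ φ_q(k)e^{-c}. -/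
theorem siteFactor_exp_mul_le {p q : ℝ} (hp : 0 ≤ p) (hpq : p ≤ q) (hq : q ≤ 1) {k : ℕ}
    (hk : k ≠ 0) :
    Real.exp ((1 - Real.exp (-1)) * (q - p)) * siteFactor p k ≤ siteFactor q k := by
  set c := (1 - Real.exp (-1)) * (q - p) with hc
  have h1 : siteFactor p k ≤ siteFactor q k * (1 - c) := by
    have h2 := siteFactor_le_one hq k
    have h3 : siteFactor q k - siteFactor p k = (q - p) * (1 - Real.exp (-(k : ℝ))) := by
      simp only [siteFactor]; ring
    have h4 := exp_neg_natCast_le hk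
    have h5 : Real.exp (-1) < 1 := Real.exp_lt_one_iff.2 (by norm_num)
    have hc0 : 0 ≤ c := mul_nonneg (by linarith) (by linarith)
    have h6 : c ≤ (q - p) * (1 - Real.exp (-(k : ℝ))) := by rw [hc]; nlinarith
    nlinarith
  have h2 : 1 - c ≤ Real.exp (-c) := by linarith [Real.add_one_le_exp (-c)]
  calc Real.exp c * siteFactor p k ≤ Real.exp c * (siteFactor q k * Real.exp (-c)) := by
        gcongr
        exact h1.trans (mul_le_mul_of_nonneg_left h2 (siteFactor_pos (hp.trans hpq) k).le)
    _ = siteFactor q k := by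
        rw [mul_left_comm, ← Real.exp_add, add_neg_cancel, Real.exp_zero, mul_one]

/-- Indeed qφ_p(k) - pφ_q(k) = (q-p)e^{-k} ≥ 0. -/
theorem siteFactor_le_div_mul {p q : ℝ} (hp : 0 < p) (hpq : p ≤ q) (k : ℕ) :
    siteFactor q k ≤ q / p * siteFactor p k := by
  rw [div_mul_eq_mul_div, le_div_iff₀ hp]
  simp only [siteFactor]
  nlinarith [Real.exp_pos (-(k : ℝ))]

variable {β : Type*} [DecidableEq β]

/-- The annealed weight of a list of visited sites. -/
def listWeight (r : ℝ) (L : List β) : ℝ := ∏ z ∈ L.toFinset, siteFactor r (L.count z)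

theorem listWeight_eq_prod {r : ℝ} {L : List β} {s : Finset β} (h : L.toFinset ⊆ s) :
    listWeight r L = ∏ z ∈ s, siteFactor r (L.count z) := by
  refine Finset.prod_subset h fun z _ hz => ?_
  rw [List.mem_toFinset] at hz
  simp [List.count_eq_zero_of_not_mem hz]

theorem listWeight_pos {r : ℝ} (hr0 : 0 ≤ r) (L : List β) : 0 < listWeight r L :=
  Finset.prod_pos fun _ _ => siteFactor_pos hr0 _

theorem listWeight_le_of_count_le {r : ℝ} (hr0 : 0 ≤ r) (hr1 : r ≤ 1) {L L' : List β}
    (h : ∀ z, L.count z ≤ L'.count z) : listWeight r L' ≤ listWeight r L := by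
  have hs : L.toFinset ⊆ L'.toFinset := by
    intro z hz
    rw [List.mem_toFinset, ← List.count_pos_iff] at *
    exact hz.trans_le (h z)
  rw [listWeight_eq_prod hs, listWeight]
  exact Finset.prod_le_prod (fun _ _ => (siteFactor_pos hr0 _).le)
    fun z _ => siteFactor_antitone hr1 (h z)

theorem listWeight_mul_le {r : ℝ} (hr0 : 0 ≤ r) (hr1 : r ≤ 1) (L L' : List β) :
    listWeight r L * listWeight r L' ≤ listWeight r (L ++ L') := by
  have hs : (L ++ L').toFinset = L.toFinset ∪ L'.toFinset := by simp
  rw [listWeight_eq_prod (s := L.toFinset ∪ L'.toFinset) (L := L) Finset.subset_union_left,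
    listWeight_eq_prod (s := L.toFinset ∪ L'.toFinset) (L := L') Finset.subset_union_right,
    listWeight_eq_prod hs.le, ← Finset.prod_mul_distrib]
  refine Finset.prod_le_prod (fun _ _ => (mul_pos (siteFactor_pos hr0 _)
    (siteFactor_pos hr0 _)).le) fun z _ => ?_
  rw [List.count_append]
  exact siteFactor_mul_le hr0 hr1 _ _

theorem listWeight_map {γ : Type*} [DecidableEq γ] (r : ℝ) (L : List β) {e : β → γ}
    (he : Function.Injective e) : listWeight r (L.map e) = listWeight r L := by
  have : (L.map e).toFinset = L.toFinset.image e := by ext; simp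
  rw [listWeight, listWeight, this, Finset.prod_image he.injOn]
  simp [List.count_map_of_injective _ _ he]

theorem count_ne_zero_of_mem_toFinset {L : List β} {z : β} (h : z ∈ L.toFinset) :
    L.count z ≠ 0 := by
  rwa [List.mem_toFinset, ← List.count_pos_iff, pos_iff_ne_zero] at h

theorem listWeight_le_pow {r : ℝ} (hr0 : 0 ≤ r) (hr1 : r ≤ 1) (L : List β) :
    listWeight r L ≤ siteFactor r 1 ^ L.toFinset.card := by
  rw [listWeight, ← Finset.prod_const]
  exact Finset.prod_le_prod (fun _ _ => (siteFactor_pos hr0 _).le)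
    fun z hz => siteFactor_le_of_ne_zero hr1 (count_ne_zero_of_mem_toFinset hz)

theorem listWeight_exp_mul_le {p q : ℝ} (hp : 0 ≤ p) (hpq : p ≤ q) (hq : q ≤ 1) (L : List β) :
    Real.exp ((1 - Real.exp (-1)) * (q - p)) ^ L.toFinset.card * listWeight p L ≤
      listWeight q L := by
  rw [listWeight, listWeight, ← Finset.prod_const, ← Finset.prod_mul_distrib]
  exact Finset.prod_le_prod
    (fun z _ => (mul_pos (Real.exp_pos _) (siteFactor_pos hp _)).le)
    fun z hz => siteFactor_exp_mul_le hp hpq hq (count_ne_zero_of_mem_toFinset hz)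

theorem listWeight_le_div_pow_mul {p q : ℝ} (hp : 0 < p) (hpq : p ≤ q) (L : List β) :
    listWeight q L ≤ (q / p) ^ L.toFinset.card * listWeight p L := by
  rw [listWeight, listWeight, ← Finset.prod_const, ← Finset.prod_mul_distrib]
  exact Finset.prod_le_prod (fun z _ => (siteFactor_pos (hp.le.trans hpq) _).le)
    fun z _ => siteFactor_le_div_mul hp hpq _

end Weights

/-! ### Total weight of first passages: supermultiplicativity and exponential bounds -/

section PassageWeight

variable {d : ℕ}

/-- The annealed weight of all paths from the origin to `y`, stopped at their first visit to `y`. -/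
def passageWeight (r : ℝ) (y : Fin d → ℤ) : ℝ≥0∞ :=
  ∑' l : {l : List (Fin d × Bool) // IsFirstPassage 0 y l},
    wordProb l.1 * ENNReal.ofReal (listWeight r (sites 0 l.1))

theorem one_le_passageWeight_zero (r : ℝ) : 1 ≤ passageWeight r (0 : Fin d → ℤ) := by
  refine le_trans ?_ (ENNReal.le_tsum ⟨[], rfl, by simp [sites]⟩)
  simp [sites, listWeight]

/-- Reflecting all steps preserves word probabilities and visit counts. -/
theorem passageWeight_neg (r : ℝ) (y : Fin d → ℤ) : passageWeight r (-y) = passageWeight r y := by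
  have key : ∀ (y : Fin d → ℤ) (l : List (Fin d × Bool)), IsFirstPassage 0 y l →
      IsFirstPassage 0 (-y) (l.map (flipStep d)) := by
    intro y l hl
    constructor
    · rw [← hl.1, ← endpoint_map_flipStep, neg_zero]
    · rw [← neg_zero, sites_map_flipStep]
      simpa using hl.2
  have hinv : ∀ l : List (Fin d × Bool), (l.map (flipStep d)).map (flipStep d) = l := by
    intro l
    rw [List.map_map]
    convert List.map_id l
    ext s <;> simp [flipStep]
  let e : {l : List (Fin d × Bool) // IsFirstPassage 0 y l} ≃
      {l : List (Fin d × Bool) // IsFirstPassage 0 (-y) l} :=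
    { toFun := fun l => ⟨l.1.map (flipStep d), key y l.1 l.2⟩
      invFun := fun l => ⟨l.1.map (flipStep d), by simpa using key (-y) l.1 l.2⟩
      left_inv := fun l => Subtype.ext (hinv l.1)
      right_inv := fun l => Subtype.ext (hinv l.1) }
  rw [passageWeight, passageWeight, ← e.tsum_eq]
  refine tsum_congr fun l => ?_
  have : sites 0 (l.1.map (flipStep d)) = (sites 0 l.1).map Neg.neg := by
    simpa using sites_map_flipStep (0 : Fin d → ℤ) l.1
  change wordProb (l.1.map (flipStep d)) * ENNReal.ofReal (listWeight r
    (sites 0 (l.1.map (flipStep d)))) = _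
  rw [wordProb_map, this, listWeight_map _ _ neg_injective]

theorem IsFirstPassage.latticeNorm_le {y : Fin d → ℤ} {l : List (Fin d × Bool)}
    (h : IsFirstPassage 0 y l) : latticeNorm y ≤ (sites 0 l).toFinset.card := by
  simpa using latticeNorm_le_card_sites h.1

theorem passageWeight_exp_mul_le {p q : ℝ} (hp : 0 ≤ p) (hpq : p ≤ q) (hq : q ≤ 1)
    (y : Fin d → ℤ) :
    ENNReal.ofReal (Real.exp ((1 - Real.exp (-1)) * (q - p)) ^ latticeNorm y) *
      passageWeight p y ≤ passageWeight q y := by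
  rw [passageWeight, passageWeight, ← ENNReal.tsum_mul_left]
  refine ENNReal.tsum_le_tsum fun l => ?_
  rw [mul_left_comm, ← ENNReal.ofReal_mul (by positivity)]
  gcongr
  have h1 : 1 ≤ Real.exp ((1 - Real.exp (-1)) * (q - p)) :=
    Real.one_le_exp (mul_nonneg (sub_nonneg.2 (Real.exp_le_one_iff.2 (by norm_num)))
      (sub_nonneg.2 hpq))
  refine le_trans ?_ (listWeight_exp_mul_le hp hpq hq _)
  exact mul_le_mul_of_nonneg_right (pow_le_pow_right₀ h1 l.2.latticeNorm_le)
    (listWeight_pos hp _).le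

variable [NeZero d]

/-- Concatenation of paths and the positive association of the potential give
supermultiplicativity. -/
theorem passageWeight_mul_le {r : ℝ} (hr0 : 0 ≤ r) (hr1 : r ≤ 1) (x y : Fin d → ℤ) :
    passageWeight r x * passageWeight r y ≤ passageWeight r (x + y) := by
  have hsites : ∀ l l' : List (Fin d × Bool), endpoint 0 l = x →
      sites 0 (l ++ l') = sites 0 l ++ (sites 0 l').map (x + ·) := by
    intro l l' h
    rw [sites_append, h, ← sites_add, add_zero]
  calc passageWeight r x * passageWeight r y
      = ∑' p : {l : List (Fin d × Bool) // IsFirstPassage 0 x l} ×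
          {l : List (Fin d × Bool) // IsFirstPassage 0 y l},
          wordProb (p.1.1 ++ p.2.1) * ENNReal.ofReal
            (listWeight r (sites 0 p.1.1) * listWeight r (sites 0 p.2.1)) := by
        rw [ENNReal.tsum_prod', passageWeight, passageWeight, ← ENNReal.tsum_mul_right]
        refine tsum_congr fun l => ?_
        rw [← ENNReal.tsum_mul_left]
        refine tsum_congr fun l' => ?_
        rw [wordProb_append, ENNReal.ofReal_mul (listWeight_pos hr0 _).le]
        ring
    _ ≤ _ := by
        refine tsum_wordProb_mul_le_of_prefix _
          (fun l : {l : List (Fin d × Bool) // IsFirstPassage 0 (x + y) l} => l.1) _ _ ?_ ?_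
        -- Concatenations are prefix-free because the first factor is recovered as the only prefix
        -- that is a first passage to `x`.
        · rintro ⟨⟨l₁, h₁⟩, ⟨l₂, h₂⟩⟩ ⟨⟨m₁, k₁⟩, ⟨m₂, k₂⟩⟩ h
          have h' : l₁ = m₁ := by
            rcases List.prefix_or_prefix_of_prefix ((List.prefix_append _ _).trans h)
              (List.prefix_append m₁ m₂) with h' | h'
            · exact h₁.eq_of_prefix k₁ h'
            · exact (k₁.eq_of_prefix h₁ h').symm
          subst h'
          have := h₂.eq_of_prefix k₂ ((List.prefix_append_right_inj _).1 h)
          subst this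
          rfl
        · rintro ⟨⟨l₁, h₁⟩, ⟨l₂, h₂⟩⟩
          have hend : endpoint 0 (l₁ ++ l₂) = x + y := by
            rw [endpoint_append, h₁.1, ← add_zero x, endpoint_add, h₂.1, add_zero]
          -- The concatenation may reach `x + y` before its end; truncating it at the first visit
          -- can only increase the weight.
          obtain ⟨l, hl, hl'⟩ := exists_prefix_isFirstPassage hend
          refine ⟨⟨l, hl'⟩, hl, ENNReal.ofReal_le_ofReal ?_⟩
          calc listWeight r (sites 0 l₁) * listWeight r (sites 0 l₂)
              = listWeight r (sites 0 l₁) * listWeight r ((sites 0 l₂).map (x + ·)) := by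
                rw [listWeight_map _ _ (add_right_injective x)]
            _ ≤ listWeight r (sites 0 (l₁ ++ l₂)) := by
                rw [hsites _ _ h₁.1]
                exact listWeight_mul_le hr0 hr1 _ _
            _ ≤ listWeight r (sites 0 l) := by
                obtain ⟨t, ht⟩ := hl
                refine listWeight_le_of_count_le hr0 hr1 fun z => ?_
                rw [← ht, sites_append, List.count_append]
                exact Nat.le_add_right _ _

theorem tsum_wordProb_firstPassage_le_one (x y : Fin d → ℤ) :
    ∑' l : {l : List (Fin d × Bool) // IsFirstPassage x y l}, wordProb l.1 ≤ 1 :=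
  tsum_wordProb_le_one _ fun l l' h => Subtype.ext (l.2.eq_of_prefix l'.2 h)

/-- Every visited site costs at least a factor `siteFactor r 1`, and the path probabilities sum to
at most one. For `r < 1` this is what makes the exponent definite. -/
theorem passageWeight_le_pow {r : ℝ} (hr0 : 0 ≤ r) (hr1 : r ≤ 1) (y : Fin d → ℤ) :
    passageWeight r y ≤ ENNReal.ofReal (siteFactor r 1 ^ latticeNorm y) := by
  calc passageWeight r y
      ≤ ∑' l : {l : List (Fin d × Bool) // IsFirstPassage 0 y l},
          wordProb l.1 * ENNReal.ofReal (siteFactor r 1 ^ latticeNorm y) := by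
        refine ENNReal.tsum_le_tsum fun l => ?_
        gcongr
        exact (listWeight_le_pow hr0 hr1 _).trans (pow_le_pow_of_le_one (siteFactor_pos hr0 _).le
          (siteFactor_le_one hr1 _) l.2.latticeNorm_le)
    _ ≤ 1 * ENNReal.ofReal (siteFactor r 1 ^ latticeNorm y) := by
        rw [ENNReal.tsum_mul_right]
        gcongr
        exact tsum_wordProb_firstPassage_le_one _ _
    _ = _ := one_mul _

theorem passageWeight_ne_top {r : ℝ} (hr0 : 0 ≤ r) (hr1 : r ≤ 1) (y : Fin d → ℤ) :
    passageWeight r y ≠ ∞ :=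
  ((passageWeight_le_pow hr0 hr1 y).trans_lt ENNReal.ofReal_lt_top).ne

/-- The probability of a step times the least mean weight of a site. -/
def stepCost (d : ℕ) : ℝ := ((Fintype.card (Fin d × Bool) : ℝ))⁻¹ * Real.exp (-1)

theorem stepCost_pos : 0 < stepCost d := by
  have : 0 < Fintype.card (Fin d × Bool) := Fintype.card_pos
  unfold stepCost
  positivity

theorem stepCost_lt_one : stepCost d < 1 := by
  have h : 1 ≤ Fintype.card (Fin d × Bool) := Fintype.card_pos
  have h1 : ((Fintype.card (Fin d × Bool) : ℝ))⁻¹ ≤ 1 := inv_le_one_of_one_le₀ (by exact_mod_cast h)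
  have h2 : Real.exp (-1) < 1 := Real.exp_lt_one_iff.2 (by norm_num)
  unfold stepCost
  nlinarith [Real.exp_pos (-1)]

theorem stepCost_le_passageWeight_unitStep {r : ℝ} (hr0 : 0 ≤ r) (s : Fin d × Bool) :
    ENNReal.ofReal (stepCost d) ≤ passageWeight r (unitStep s) := by
  have hs : unitStep s ≠ 0 := fun h => by
    simpa [latticeNorm_unitStep] using latticeNorm_eq_zero.2 h
  refine le_trans ?_ (ENNReal.le_tsum ⟨[s], by simp [endpoint], by simpa [sites] using hs⟩)
  have hw : listWeight r (sites 0 [s]) = siteFactor r 1 := by simp [sites, listWeight]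
  have hc : (0 : ℝ) < Fintype.card (Fin d × Bool) := by exact_mod_cast Fintype.card_pos
  dsimp only
  rw [hw, stepCost, ENNReal.ofReal_mul (inv_pos.2 hc).le, ENNReal.ofReal_inv_of_pos hc,
    ENNReal.ofReal_natCast, wordProb, List.length_singleton, pow_one]
  gcongr
  exact exp_neg_one_le_siteFactor_one hr0

/-- Follow a shortest path, one unit step at a time. The base does not depend on `r`, which later
makes the constants uniform in the parameters. -/
theorem stepCost_pow_le_passageWeight {r : ℝ} (hr0 : 0 ≤ r) (hr1 : r ≤ 1) (y : Fin d → ℤ) :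
    ENNReal.ofReal (stepCost d ^ latticeNorm y) ≤ passageWeight r y := by
  induction hn : latticeNorm y generalizing y with
  | zero =>
    rw [latticeNorm_eq_zero.1 hn]
    simpa using one_le_passageWeight_zero r
  | succ n ih =>
    have hy : y ≠ 0 := fun h => by rw [latticeNorm_eq_zero.2 h] at hn; omega
    obtain ⟨s, hs⟩ := exists_latticeNorm_sub_unitStep hy
    calc ENNReal.ofReal (stepCost d ^ (n + 1))
        = ENNReal.ofReal (stepCost d ^ n) * ENNReal.ofReal (stepCost d) := by
          rw [pow_succ, ENNReal.ofReal_mul (pow_pos stepCost_pos _).le]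
      _ ≤ passageWeight r (y - unitStep s) * passageWeight r (unitStep s) := by
          gcongr
          · exact ih _ (by omega)
          · exact stepCost_le_passageWeight_unitStep hr0 s
      _ ≤ passageWeight r y := by
          simpa using passageWeight_mul_le hr0 hr1 (y - unitStep s) (unitStep s)

/-- Paths that visit more than `N` sites contribute at most `ρ ^ N`, and on the others the
weights for the parameters `p` and `q` differ at most by the factor `(q / p) ^ N`. -/
theorem passageWeight_le_div_pow_mul_add {p q : ℝ} (hp : 0 < p) (hpq : p ≤ q) (hq : q ≤ 1)
    (y : Fin d → ℤ) (N : ℕ) :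
    passageWeight q y ≤ ENNReal.ofReal ((q / p) ^ N) * passageWeight p y +
      ENNReal.ofReal (siteFactor q 1 ^ N) := by
  have hq0 : 0 ≤ q := hp.le.trans hpq
  calc passageWeight q y
      ≤ ∑' l : {l : List (Fin d × Bool) // IsFirstPassage 0 y l},
          (ENNReal.ofReal ((q / p) ^ N) *
            (wordProb l.1 * ENNReal.ofReal (listWeight p (sites 0 l.1))) +
            wordProb l.1 * ENNReal.ofReal (siteFactor q 1 ^ N)) := by
        refine ENNReal.tsum_le_tsum fun l => ?_
        rw [mul_left_comm, ← ENNReal.ofReal_mul (by positivity), ← mul_add,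
          ← ENNReal.ofReal_add (mul_nonneg (by positivity) (listWeight_pos hp.le _).le)
            (pow_nonneg (siteFactor_pos hq0 _).le _)]
        gcongr
        rcases le_total (sites 0 l.1).toFinset.card N with h | h
        · refine le_add_of_le_of_nonneg ((listWeight_le_div_pow_mul hp hpq _).trans ?_)
            (pow_nonneg (siteFactor_pos hq0 _).le _)
          exact mul_le_mul_of_nonneg_right (pow_le_pow_right₀ ((one_le_div hp).2 hpq) h)
            (listWeight_pos hp.le _).le
        · refine le_add_of_nonneg_of_le (mul_nonneg (by positivity) (listWeight_pos hp.le _).le)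
            ((listWeight_le_pow hq0 hq _).trans ?_)
          exact pow_le_pow_of_le_one (siteFactor_pos hq0 _).le (siteFactor_le_one hq _) h
    _ ≤ _ := by
        rw [ENNReal.tsum_add, ENNReal.tsum_mul_left, ENNReal.tsum_mul_right]
        gcongr
        · exact le_rfl
        · exact mul_le_of_le_one_left' (tsum_wordProb_firstPassage_le_one _ _)

end PassageWeight

/-! ### Transience in dimensions `d ≥ 3` via an explicit superharmonic function -/

section Transience

variable {d : ℕ}

/-- The Taylor coefficient of u² is 5/32, slightly less than 3/16. The slack leaves a term u²/8 in
the fourth-power comparison, which absorbs all higher powers when |u| ≤ 1/10. -/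
theorem rpow_neg_quarter_one_add_le {u : ℝ} (hu : |u| ≤ 1 / 10) :
    (1 + u) ^ (-(1 / 4) : ℝ) ≤ 1 - u / 4 + 3 / 16 * u ^ 2 := by
  obtain ⟨h1, h2⟩ := abs_le.1 hu
  have hg : 0 < 1 - u / 4 + 3 / 16 * u ^ 2 := by nlinarith
  set g := 1 - u / 4 + 3 / 16 * u ^ 2 with hgdef
  have key : 1 ≤ g ^ 4 * (1 + u) := by
    have e : g ^ 4 * (1 + u) = 1 + u ^ 2 *
        (1 / 8 + 1 / 2 * u + (-69/256) * u ^ 2 + (61/256) * u ^ 3 +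
          (-159/2048) * u ^ 4 + (135/4096) * u ^ 5 + (-351/65536) * u ^ 6 + (81/65536) * u ^ 7) := by
      rw [hgdef]; ring
    rw [e]
    refine le_add_of_nonneg_right (mul_nonneg (sq_nonneg u) ?_)
    have hpow : ∀ k : ℕ, |u ^ k| ≤ (1 / 10) ^ k := fun k => by
      rw [abs_pow]; exact pow_le_pow_left₀ (abs_nonneg u) hu k
    have b2 := abs_le.1 (hpow 2)
    have b3 := abs_le.1 (hpow 3)
    have b4 := abs_le.1 (hpow 4)
    have b5 := abs_le.1 (hpow 5)
    have b6 := abs_le.1 (hpow 6)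
    have b7 := abs_le.1 (hpow 7)
    norm_num at b2 b3 b4 b5 b6 b7
    linarith [b2.1, b2.2, b3.1, b3.2, b4.1, b4.2, b5.1, b5.2, b6.1, b6.2, b7.1, b7.2]
  have h0 : (0 : ℝ) < 1 + u := by linarith
  rw [Real.rpow_neg h0.le, ← Real.inv_rpow h0.le]
  calc ((1 + u)⁻¹) ^ (1 / 4 : ℝ) ≤ (g ^ 4) ^ (1 / 4 : ℝ) := by
        gcongr
        rwa [inv_le_iff_one_le_mul₀ h0]
    _ = g := by
        rw [← Real.rpow_natCast, ← Real.rpow_mul hg.le]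
        norm_num

theorem rpow_neg_quarter_mul_le {t : ℝ} (ht : 1 < t) :
    t ^ (-(1 / 4) : ℝ) * (1 + 1 / (4 * t)) ≤ (t - 1) ^ (-(1 / 4) : ℝ) := by
  have h0 : 0 < t := by linarith
  have h1 : 0 < t - 1 := by linarith
  have e1 : 1 + 1 / (4 * t) ≤ Real.exp (1 / (4 * t)) := by
    linarith [Real.add_one_le_exp (1 / (4 * t))]
  have e2 : 1 - 1 / t ≤ Real.exp (-(1 / t)) := by linarith [Real.add_one_le_exp (-(1 / t))]
  have h2 : t - 1 ≤ t * Real.exp (-(1 / t)) := by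
    calc t - 1 = t * (1 - 1 / t) := by field_simp
      _ ≤ _ := by gcongr
  calc t ^ (-(1 / 4) : ℝ) * (1 + 1 / (4 * t))
      ≤ t ^ (-(1 / 4) : ℝ) * Real.exp (1 / (4 * t)) := by gcongr
    _ = (t * Real.exp (-(1 / t))) ^ (-(1 / 4) : ℝ) := by
        rw [Real.mul_rpow h0.le (Real.exp_pos _).le, ← Real.exp_mul]
        congr 2
        field_simp
    _ ≤ _ := Real.rpow_le_rpow_of_nonpos h1 h2 (by norm_num)

/-- A function on the lattice which is superharmonic in dimensions `d ≥ 3`. -/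
def barrier (x : Fin d → ℤ) : ℝ := ((∑ i, (x i : ℝ) ^ 2) + 400) ^ (-(1 / 4) : ℝ)

theorem barrier_pos (x : Fin d → ℤ) : 0 < barrier x := by
  unfold barrier
  positivity

theorem barrier_add_unitStep (x : Fin d → ℤ) (s : Fin d × Bool) :
    barrier (x + unitStep s) =
      ((∑ i, (x i : ℝ) ^ 2) + 401 + (if s.2 then 1 else -1) * (2 * x s.1)) ^ (-(1 / 4) : ℝ) := by
  rw [barrier]
  congr 1
  rw [← Finset.add_sum_erase _ _ (Finset.mem_univ s.1),
    ← Finset.add_sum_erase Finset.univ (fun i => (x i : ℝ) ^ 2) (Finset.mem_univ s.1)]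
  have : ∑ i ∈ Finset.univ.erase s.1, (((x + unitStep s) i : ℤ) : ℝ) ^ 2 =
      ∑ i ∈ Finset.univ.erase s.1, (x i : ℝ) ^ 2 := by
    refine Finset.sum_congr rfl fun j hj => ?_
    simp [unitStep, Pi.single_eq_of_ne (Finset.ne_of_mem_erase hj)]
  rw [this]
  simp only [unitStep, Pi.add_apply, Pi.single_eq_same]
  split_ifs <;> push_cast <;> ring

/-- With t = |x|² + 401, the neighbours have values (t ± 2x_i)^{-1/4} and `x` itself has
(t-1)^{-1/4}. Terms linear in x_i cancel between opposite steps. Relative to t^{-1/4}, the quadratic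
ones sum to at most 3/(2t), while the shift from t to t-1 gains at least d/(2t) in total; this is
where d ≥ 3 enters. -/
theorem sum_barrier_le (x : Fin d → ℤ) (hd : 3 ≤ d) :
    ∑ s : Fin d × Bool, barrier (x + unitStep s) ≤ 2 * d * barrier x := by
  set S : ℝ := ∑ i, (x i : ℝ) ^ 2 with hS
  have hS0 : 0 ≤ S := Finset.sum_nonneg fun i _ => sq_nonneg _
  have ht : (401 : ℝ) ≤ S + 401 := by linarith
  set t := S + 401 with htdef
  have ht0 : 0 < t := by linarith
  have hd' : (3 : ℝ) ≤ d := by exact_mod_cast hd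
  have hterm : ∀ i, (t + 2 * x i) ^ (-(1 / 4) : ℝ) + (t - 2 * x i) ^ (-(1 / 4) : ℝ) ≤
      t ^ (-(1 / 4) : ℝ) * (2 + 3 / 2 * (x i : ℝ) ^ 2 / t ^ 2) := by
    intro i
    have hi : (x i : ℝ) ^ 2 ≤ S :=
      Finset.single_le_sum (f := fun i => (x i : ℝ) ^ 2) (fun i _ => sq_nonneg _) (Finset.mem_univ i)
    set u := 2 * (x i : ℝ) / t with hu
    -- The shift 400 in `barrier` serves this bound: u² ≤ 4S/(S+401)² ≤ 1/100.
    have hu1 : |u| ≤ 1 / 10 := by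
      refine abs_le_of_sq_le_sq (by
        rw [hu, div_pow, div_le_iff₀ (by positivity)]
        nlinarith) (by norm_num)
    have h1 := rpow_neg_quarter_one_add_le hu1
    have h2 := rpow_neg_quarter_one_add_le (u := -u) (by rwa [abs_neg])
    obtain ⟨h3, h4⟩ := abs_le.1 hu1
    have e1 : t + 2 * x i = t * (1 + u) := by rw [hu]; field_simp
    have e2 : t - 2 * x i = t * (1 + -u) := by rw [hu]; field_simp; ring
    have e3 : 3 / 2 * (x i : ℝ) ^ 2 / t ^ 2 = 3 / 8 * u ^ 2 := by rw [hu]; field_simp; ring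
    rw [e1, e2, e3, Real.mul_rpow ht0.le (by linarith), Real.mul_rpow ht0.le (by linarith),
      ← mul_add]
    refine mul_le_mul_of_nonneg_left ?_ (Real.rpow_nonneg ht0.le _)
    linarith
  calc ∑ s : Fin d × Bool, barrier (x + unitStep s)
      = ∑ i, ((t + 2 * x i) ^ (-(1 / 4) : ℝ) + (t - 2 * x i) ^ (-(1 / 4) : ℝ)) := by
        simp only [barrier_add_unitStep, Fintype.sum_prod_type, Fintype.sum_bool]
        simp [htdef, hS, sub_eq_add_neg]
    _ ≤ ∑ i, t ^ (-(1 / 4) : ℝ) * (2 + 3 / 2 * (x i : ℝ) ^ 2 / t ^ 2) :=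
        Finset.sum_le_sum fun i _ => hterm i
    _ = t ^ (-(1 / 4) : ℝ) * (2 * d + 3 / 2 * S / t ^ 2) := by
        rw [← Finset.mul_sum, Finset.sum_add_distrib, ← Finset.sum_div, ← Finset.mul_sum]
        rw [← hS, Finset.sum_const, Finset.card_univ, Fintype.card_fin, nsmul_eq_mul,
          mul_comm (d : ℝ) 2]
    _ ≤ t ^ (-(1 / 4) : ℝ) * (2 * d * (1 + 1 / (4 * t))) := by
        gcongr
        have h1 : 3 / 2 * S / t ^ 2 ≤ 3 / 2 / t := by
          rw [div_le_div_iff₀ (by positivity) ht0]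
          nlinarith [mul_pos ht0 ht0]
        have h2 : 2 * (d : ℝ) * (1 + 1 / (4 * t)) = 2 * d + (d / 2) / t := by field_simp; ring
        have h3 : 3 / 2 / t ≤ ((d : ℝ) / 2) / t := by gcongr
        linarith
    _ = 2 * d * (t ^ (-(1 / 4) : ℝ) * (1 + 1 / (4 * t))) := by ring
    _ ≤ 2 * d * (t - 1) ^ (-(1 / 4) : ℝ) := by
        gcongr
        exact rpow_neg_quarter_mul_le (by linarith)
    _ = 2 * d * barrier x := by
        rw [barrier, htdef]
        congr 2
        ring

/-- The amount by which the barrier fails to be harmonic at the origin. -/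
def barrierGap : ℝ := (400 : ℝ) ^ (-(1 / 4) : ℝ) - (401 : ℝ) ^ (-(1 / 4) : ℝ)

theorem barrierGap_pos : 0 < barrierGap :=
  sub_pos.2 (Real.rpow_lt_rpow_of_neg (by norm_num) (by norm_num) (by norm_num))

theorem sum_barrier_add_gap_le (x : Fin d → ℤ) (hd : 3 ≤ d) :
    (∑ s : Fin d × Bool, barrier (x + unitStep s)) + 2 * d * (if x = 0 then barrierGap else 0) ≤
      2 * d * barrier x := by
  split_ifs with hx
  · subst hx
    simp only [barrier_add_unitStep]
    simp only [barrier, barrierGap, Fintype.sum_prod_type, Fintype.sum_bool]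
    simp
    ring_nf
    exact le_rfl
  · simpa using sum_barrier_le x hd

/-- The mean number of visits to the origin before time `n`. -/
def truncatedGreen (n : ℕ) (x : Fin d → ℤ) : ℝ≥0∞ :=
  ∑' l : List (Fin d × Bool), if l.length < n ∧ endpoint x l = 0 then wordProb l else 0

theorem tsum_list {α : Type*} (f : List α → ℝ≥0∞) :
    ∑' l, f l = f [] + ∑' (s : α) (l : List α), f (s :: l) := by
  let e : Unit ⊕ (α × List α) ≃ List α :=
    { toFun := Sum.elim (fun _ => []) fun p => p.1 :: p.2
      invFun := fun l => match l with
        | [] => Sum.inl ()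
        | s :: l => Sum.inr (s, l)
      left_inv := by rintro (_ | _) <;> rfl
      right_inv := by rintro (_ | _) <;> rfl }
  rw [← e.tsum_eq, ENNReal.summable.tsum_sum ENNReal.summable, ENNReal.tsum_prod', tsum_fintype]
  simp [e]

theorem truncatedGreen_succ (n : ℕ) (x : Fin d → ℤ) :
    truncatedGreen (n + 1) x = (if x = 0 then 1 else 0) +
      (Fintype.card (Fin d × Bool) : ℝ≥0∞)⁻¹ *
        ∑ s : Fin d × Bool, truncatedGreen n (x + unitStep s) := by
  rw [truncatedGreen, tsum_list, tsum_fintype, Finset.mul_sum]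
  congr 1
  · simp [endpoint]
  · refine Finset.sum_congr rfl fun s _ => ?_
    rw [truncatedGreen, ← ENNReal.tsum_mul_left]
    refine tsum_congr fun l => ?_
    simp [endpoint, wordProb, pow_succ', mul_ite]

/-- The barrier is a supersolution of the first-step recursion satisfied by the gap times the
truncated Green function. Truncation in time permits induction from the value zero. -/
theorem gap_mul_truncatedGreen_le (hd : 3 ≤ d) (n : ℕ) (x : Fin d → ℤ) :
    ENNReal.ofReal barrierGap * truncatedGreen n x ≤ ENNReal.ofReal (barrier x) := by
  induction n generalizing x with
  | zero => simp [truncatedGreen]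
  | succ n ih =>
    have hcard : Fintype.card (Fin d × Bool) = 2 * d := by simp [mul_comm]
    have hd0 : (0 : ℝ) < 2 * d := by have : (3 : ℝ) ≤ d := by exact_mod_cast hd
                                     linarith
    have hinv : (Fintype.card (Fin d × Bool) : ℝ≥0∞)⁻¹ = ENNReal.ofReal (2 * d : ℝ)⁻¹ := by
      rw [ENNReal.ofReal_inv_of_pos hd0, hcard, ← ENNReal.ofReal_natCast]
      push_cast
      rfl
    calc ENNReal.ofReal barrierGap * truncatedGreen (n + 1) x
        = ENNReal.ofReal (if x = 0 then barrierGap else 0) + ENNReal.ofReal (2 * d : ℝ)⁻¹ *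
          ∑ s : Fin d × Bool, ENNReal.ofReal barrierGap * truncatedGreen n (x + unitStep s) := by
          rw [truncatedGreen_succ, mul_add, hinv, mul_left_comm, Finset.mul_sum]
          congr 1
          split_ifs <;> simp
      _ ≤ ENNReal.ofReal (if x = 0 then barrierGap else 0) + ENNReal.ofReal (2 * d : ℝ)⁻¹ *
          ∑ s : Fin d × Bool, ENNReal.ofReal (barrier (x + unitStep s)) := by
          gcongr
          exact ih _
      _ = ENNReal.ofReal ((if x = 0 then barrierGap else 0) +
          (2 * d : ℝ)⁻¹ * ∑ s : Fin d × Bool, barrier (x + unitStep s)) := by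
          rw [← ENNReal.ofReal_sum_of_nonneg fun s _ => (barrier_pos _).le,
            ← ENNReal.ofReal_mul (by positivity), ← ENNReal.ofReal_add]
          · split_ifs
            exacts [barrierGap_pos.le, le_rfl]
          · exact mul_nonneg (by positivity) (Finset.sum_nonneg fun s _ => (barrier_pos _).le)
      _ ≤ ENNReal.ofReal (barrier x) := by
          apply ENNReal.ofReal_le_ofReal
          have := sum_barrier_add_gap_le x hd
          rw [← mul_le_mul_iff_right₀ hd0, mul_add, mul_inv_cancel_left₀ hd0.ne']
          linarith

/-- A bound for the mean number of visits of the origin in dimensions `d ≥ 3`. -/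
def greenBound : ℝ := (400 : ℝ) ^ (-(1 / 4) : ℝ) / barrierGap

/-- **Transience** of the simple random walk in dimensions `d ≥ 3`. -/
theorem tsum_wordProb_loop_le (hd : 3 ≤ d) :
    ∑' l : {l : List (Fin d × Bool) // endpoint 0 l = 0}, wordProb l.1 ≤
      ENNReal.ofReal greenBound := by
  have h : ∀ n, truncatedGreen n (0 : Fin d → ℤ) ≤ ENNReal.ofReal greenBound := by
    intro n
    have := gap_mul_truncatedGreen_le hd n 0
    rw [greenBound, ENNReal.ofReal_div_of_pos barrierGap_pos]
    rw [ENNReal.le_div_iff_mul_le (Or.inl (ENNReal.ofReal_pos.2 barrierGap_pos).ne')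
      (Or.inl ENNReal.ofReal_ne_top), mul_comm]
    simpa [barrier] using this
  rw [ENNReal.tsum_eq_iSup_sum]
  -- Finitely many loops have bounded length, so one truncated Green function counts them all.
  refine iSup_le fun T => le_trans ?_ (h (T.sup (fun l => l.1.length) + 1))
  calc ∑ l ∈ T, wordProb l.1
      = ∑ l ∈ T, if l.1.length < T.sup (fun l => l.1.length) + 1 ∧ endpoint 0 l.1 = 0
          then wordProb l.1 else 0 := by
        refine Finset.sum_congr rfl fun l hl => ?_
        rw [if_pos ⟨Nat.lt_succ_of_le (Finset.le_sup (f := fun l => l.1.length) hl), l.2⟩]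
    _ ≤ _ := by
        refine (ENNReal.sum_le_tsum T).trans ?_
        exact ENNReal.tsum_comp_le_tsum_of_injective Subtype.val_injective
          fun l : List (Fin d × Bool) => if l.length < T.sup (fun l => l.1.length) + 1 ∧
            endpoint 0 l = 0 then wordProb l else 0

end Transience

/-! ### Effect of the parameter in dimensions `d ≥ 3`: removing a site and cutting loops -/

section ParameterDependence

/-- Replace the factors `f` by `g` one at a time and bound the untouched factors by `g`. -/
theorem prod_le_prod_add_sum_erase {β : Type*} [DecidableEq β] (s : Finset β) (f g : β → ℝ)
    (hf : ∀ z, 0 ≤ f z) (hfg : ∀ z, f z ≤ g z) :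
    ∏ z ∈ s, g z ≤ ∏ z ∈ s, f z + ∑ z ∈ s, (g z - f z) * ∏ w ∈ s.erase z, g w := by
  induction s using Finset.induction_on with
  | empty => simp
  | insert a s ha ih =>
    have hg : ∀ z, 0 ≤ g z := fun z => (hf z).trans (hfg z)
    rw [Finset.prod_insert ha, Finset.prod_insert ha, Finset.sum_insert ha, Finset.erase_insert ha]
    have h1 : ∑ z ∈ s, (g z - f z) * ∏ w ∈ (insert a s).erase z, g w =
        g a * ∑ z ∈ s, (g z - f z) * ∏ w ∈ s.erase z, g w := by
      rw [Finset.mul_sum]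
      refine Finset.sum_congr rfl fun z hz => ?_
      have hza : a ≠ z := fun h => ha (h ▸ hz)
      rw [Finset.erase_insert_of_ne hza, Finset.prod_insert (by simp [ha])]
      ring
    have h2 : 0 ≤ ∑ z ∈ s, (g z - f z) * ∏ w ∈ s.erase z, g w :=
      Finset.sum_nonneg fun z _ => mul_nonneg (sub_nonneg.2 (hfg z)) (Finset.prod_nonneg fun w _ => hg w)
    have h3 : ∏ z ∈ s, f z ≤ ∏ z ∈ s, g z := Finset.prod_le_prod (fun z _ => hf z) fun z _ => hfg z
    have h4 := mul_le_mul_of_nonneg_left ih (hf a)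
    have h5 := mul_le_mul_of_nonneg_right (hfg a) h2
    rw [h1]
    linarith

section Punctured

variable {β : Type*} [DecidableEq β]

/-- The weight of a list of visited sites without the contribution of the site `z`. -/
def puncturedWeight (r : ℝ) (L : List β) (z : β) : ℝ :=
  ∏ w ∈ L.toFinset.erase z, siteFactor r (L.count w)

theorem puncturedWeight_nonneg {r : ℝ} (hr0 : 0 ≤ r) (L : List β) (z : β) :
    0 ≤ puncturedWeight r L z :=
  Finset.prod_nonneg fun _ _ => (siteFactor_pos hr0 _).le

theorem listWeight_le_add_sum_puncturedWeight {p q : ℝ} (hp : 0 ≤ p) (hpq : p ≤ q)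
    (L : List β) :
    listWeight q L ≤ listWeight p L + (q - p) * ∑ z ∈ L.toFinset, puncturedWeight q L z := by
  refine (prod_le_prod_add_sum_erase _ (fun z => siteFactor p (L.count z)) _
    (fun z => (siteFactor_pos hp _).le) fun z => siteFactor_mono_param hpq _).trans ?_
  rw [Finset.mul_sum]
  refine add_le_add le_rfl (Finset.sum_le_sum fun z _ => ?_)
  refine mul_le_mul_of_nonneg_right ?_ (puncturedWeight_nonneg (hp.trans hpq) _ _)
  simp only [siteFactor]
  nlinarith [Real.exp_pos (-(L.count z : ℝ))]

/-- Removing visits increases the punctured weight, and a single visit costs at most a factor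
`e`. -/
theorem puncturedWeight_le_exp_mul_listWeight {r : ℝ} (hr0 : 0 ≤ r) (hr1 : r ≤ 1)
    {L L' : List β} {z : β} (h : ∀ w, L'.count w ≤ L.count w) (hz : L'.count z = 1) :
    puncturedWeight r L z ≤ Real.exp 1 * listWeight r L' := by
  have hs : L'.toFinset ⊆ L.toFinset := by
    intro w hw
    rw [List.mem_toFinset, ← List.count_pos_iff] at *
    exact hw.trans_le (h w)
  have hzL : z ∈ L.toFinset :=
    hs (List.mem_toFinset.2 (List.count_pos_iff.1 (by rw [hz]; exact one_pos)))
  rw [listWeight_eq_prod hs, ← Finset.mul_prod_erase _ _ hzL, hz, ← mul_assoc, puncturedWeight]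
  have h1 : 1 ≤ Real.exp 1 * siteFactor r 1 := by
    calc (1 : ℝ) = Real.exp 1 * Real.exp (-1) := by rw [← Real.exp_add]; simp
      _ ≤ _ := by
        gcongr
        exact exp_neg_one_le_siteFactor_one hr0
  refine le_trans ?_ (le_mul_of_one_le_left
    (Finset.prod_nonneg fun _ _ => (siteFactor_pos hr0 _).le) h1)
  exact Finset.prod_le_prod (fun _ _ => (siteFactor_pos hr0 _).le)
    fun w _ => siteFactor_antitone hr1 (h w)

end Punctured

variable {d : ℕ}

/-- The words of first passage to `y`. -/
abbrev PassageWord (y : Fin d → ℤ) : Type := {l : List (Fin d × Bool) // IsFirstPassage 0 y l}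

/-- The words of first passage to `y` that visit `z` before. -/
def passageVisiting (y z : Fin d → ℤ) : Set (PassageWord y) := {l | z ∈ sites 0 l.1}

/-- Cutting out the part of a path between its first and its last visit to `z`. -/
theorem exists_loop_decomposition {y z : Fin d → ℤ} {l : List (Fin d × Bool)}
    (hl : IsFirstPassage 0 y l) (hz : z ∈ sites 0 l) :
    ∃ l₁ c l₂, l = l₁ ++ (c ++ l₂) ∧ IsFirstPassage 0 z l₁ ∧ endpoint 0 c = 0 ∧
      IsFirstPassage 0 y (l₁ ++ l₂) ∧ (sites 0 (l₁ ++ l₂)).count z = 1 ∧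
      ∀ w, (sites 0 (l₁ ++ l₂)).count w ≤ (sites 0 l).count w := by
  obtain ⟨l₁, t, rfl, ht, h1, h2⟩ := exists_append_of_mem_sites hz
  have hzt : z ∈ sites z t := by
    cases t with
    | nil => exact absurd rfl ht
    | cons s t => simp [sites]
  obtain ⟨c, s, l₂, rfl, h3, h4⟩ := exists_append_last_of_mem_sites hzt
  have hcount : ∀ w, (sites 0 (l₁ ++ s :: l₂)).count w ≤
      (sites 0 (l₁ ++ (c ++ s :: l₂))).count w := by
    intro w
    rw [sites_append, sites_append, sites_append, h1, h3]
    simp only [List.count_append]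
    omega
  -- The last departure `s` from `z` stays in the shortened path, so `z` is occupied there exactly
  -- once rather than never.
  refine ⟨l₁, c, s :: l₂, rfl, ⟨h1, h2⟩, ?_, ⟨?_, fun hy => hl.2 ?_⟩, ?_, hcount⟩
  · have h5 := endpoint_add z 0 c
    rw [add_zero, h3] at h5
    exact left_eq_add.1 h5
  · rw [← hl.1, endpoint_append, endpoint_append, endpoint_append, h1, h3]
  · exact List.count_pos_iff.1 ((List.count_pos_iff.2 hy).trans_le (hcount y))
  · rw [sites_append, h1, List.count_append, List.count_eq_zero_of_not_mem h2]
    simp [sites, List.count_eq_zero_of_not_mem h4]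

/-- A path through `z` is encoded injectively by the path with its loop at `z` cut out and the loop
itself. The punctured weight is at most `e` times the weight of the shortened path, and the free sum
over loops is controlled by transience. -/
theorem tsum_puncturedWeight_le (hd : 3 ≤ d) {r : ℝ} (hr0 : 0 ≤ r) (hr1 : r ≤ 1)
    (y z : Fin d → ℤ) :
    ∑' l : passageVisiting y z,
        wordProb l.1.1 * ENNReal.ofReal (puncturedWeight r (sites 0 l.1.1) z) ≤
      ENNReal.ofReal (Real.exp 1 * greenBound) * ∑' l : passageVisiting y z,
        wordProb l.1.1 * ENNReal.ofReal (listWeight r (sites 0 l.1.1)) := by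
  have hdec := fun l : passageVisiting y z => exists_loop_decomposition l.1.2 l.2
  choose l₁ c l₂ h1 h2 h3 h4 h5 h6 using hdec
  let σ : passageVisiting y z → passageVisiting y z := fun l =>
    ⟨⟨l₁ l ++ l₂ l, h4 l⟩, List.count_pos_iff.1 (by rw [h5 l]; exact one_pos)⟩
  let Φ : passageVisiting y z →
      passageVisiting y z × {l : List (Fin d × Bool) // endpoint 0 l = 0} :=
    fun l => (σ l, ⟨c l, h3 l⟩)
  have hΦ : Function.Injective Φ := by
    intro l m h
    have e1 : l₁ l ++ l₂ l = l₁ m ++ l₂ m := congrArg (fun p => p.1.1.1) h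
    have e2 : c l = c m := congrArg (fun p => p.2.1) h
    -- The cutting point is recovered from the shortened path as its first visit to `z`.
    have e3 : l₁ l = l₁ m := by
      rcases List.prefix_or_prefix_of_prefix (List.prefix_append (l₁ l) (l₂ l))
        (e1 ▸ List.prefix_append (l₁ m) (l₂ m)) with h' | h'
      · exact (h2 l).eq_of_prefix (h2 m) h'
      · exact ((h2 m).eq_of_prefix (h2 l) h').symm
    have e4 : l₂ l = l₂ m := by rw [e3] at e1; exact List.append_cancel_left e1
    exact Subtype.ext (Subtype.ext (by rw [h1 l, h1 m, e2, e3, e4]))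
  let F : passageVisiting y z × {l : List (Fin d × Bool) // endpoint 0 l = 0} → ℝ≥0∞ :=
    fun p => ENNReal.ofReal (Real.exp 1) * (wordProb p.1.1.1 *
      ENNReal.ofReal (listWeight r (sites 0 p.1.1.1))) * wordProb p.2.1
  calc ∑' l : passageVisiting y z,
        wordProb l.1.1 * ENNReal.ofReal (puncturedWeight r (sites 0 l.1.1) z)
      ≤ ∑' l, F (Φ l) := by
        refine ENNReal.tsum_le_tsum fun l => ?_
        calc wordProb l.1.1 * ENNReal.ofReal (puncturedWeight r (sites 0 l.1.1) z)
            ≤ wordProb l.1.1 *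
              ENNReal.ofReal (Real.exp 1 * listWeight r (sites 0 (l₁ l ++ l₂ l))) := by
              gcongr
              exact puncturedWeight_le_exp_mul_listWeight hr0 hr1 (h6 l) (h5 l)
          _ = F (Φ l) := by
              conv_lhs => rw [h1 l]
              simp only [F, Φ, σ, wordProb_append]
              rw [ENNReal.ofReal_mul (Real.exp_pos 1).le]
              ring
    _ ≤ ∑' p, F p := ENNReal.tsum_comp_le_tsum_of_injective hΦ F
    _ = ENNReal.ofReal (Real.exp 1) * (∑' l : passageVisiting y z,
          wordProb l.1.1 * ENNReal.ofReal (listWeight r (sites 0 l.1.1))) *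
        ∑' l : {l : List (Fin d × Bool) // endpoint 0 l = 0}, wordProb l.1 := by
        rw [ENNReal.tsum_prod']
        simp only [F, ENNReal.tsum_mul_left, ENNReal.tsum_mul_right]
    _ ≤ ENNReal.ofReal (Real.exp 1) * (∑' l : passageVisiting y z,
          wordProb l.1.1 * ENNReal.ofReal (listWeight r (sites 0 l.1.1))) *
        ENNReal.ofReal greenBound := by
        gcongr
        exact tsum_wordProb_loop_le hd
    _ = _ := by
        rw [ENNReal.ofReal_mul (Real.exp_pos 1).le]
        ring

theorem tsum_tsum_passageVisiting (y : Fin d → ℤ) (f : (Fin d → ℤ) → PassageWord y → ℝ≥0∞) :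
    ∑' z, ∑' l : passageVisiting y z, f z l.1 =
      ∑' l : PassageWord y, ∑ z ∈ (sites 0 l.1).toFinset, f z l := by
  simp_rw [fun z => tsum_subtype (passageVisiting y z) (f z)]
  rw [ENNReal.tsum_comm]
  refine tsum_congr fun l => ?_
  rw [tsum_eq_sum (s := (sites 0 l.1).toFinset)]
  · refine Finset.sum_congr rfl fun z hz => Set.indicator_of_mem ?_ _
    exact List.mem_toFinset.1 hz
  · intro z hz
    refine Set.indicator_of_notMem ?_ _
    exact fun h => hz (List.mem_toFinset.2 h)

/-- A finite-difference form of a derivative bound: summing over `z` the weights of the paths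
through `z` counts each path once per visited site. -/
theorem passageWeight_le_add_tsum_card (hd : 3 ≤ d) {p q : ℝ} (hp : 0 ≤ p) (hpq : p ≤ q)
    (hq : q ≤ 1) (y : Fin d → ℤ) :
    passageWeight q y ≤ passageWeight p y + ENNReal.ofReal (q - p) *
      (ENNReal.ofReal (Real.exp 1 * greenBound) * ∑' l : PassageWord y, wordProb l.1 *
        ENNReal.ofReal ((sites 0 l.1).toFinset.card * listWeight q (sites 0 l.1))) := by
  have hq0 := hp.trans hpq
  calc passageWeight q y
      ≤ ∑' l : PassageWord y, (wordProb l.1 * ENNReal.ofReal (listWeight p (sites 0 l.1)) +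
          ENNReal.ofReal (q - p) * ∑ z ∈ (sites 0 l.1).toFinset,
            wordProb l.1 * ENNReal.ofReal (puncturedWeight q (sites 0 l.1) z)) := by
        refine ENNReal.tsum_le_tsum fun l => ?_
        rw [← Finset.mul_sum, mul_left_comm, ← mul_add,
          ← ENNReal.ofReal_sum_of_nonneg fun z _ => puncturedWeight_nonneg hq0 _ z,
          ← ENNReal.ofReal_mul (sub_nonneg.2 hpq),
          ← ENNReal.ofReal_add (listWeight_pos hp _).le (mul_nonneg (sub_nonneg.2 hpq)
            (Finset.sum_nonneg fun z _ => puncturedWeight_nonneg hq0 _ z))]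
        gcongr
        exact listWeight_le_add_sum_puncturedWeight hp hpq _
    _ = passageWeight p y + ENNReal.ofReal (q - p) * ∑' z, ∑' l : passageVisiting y z,
          wordProb l.1.1 * ENNReal.ofReal (puncturedWeight q (sites 0 l.1.1) z) := by
        rw [ENNReal.tsum_add, ENNReal.tsum_mul_left, tsum_tsum_passageVisiting y fun z l =>
          wordProb l.1 * ENNReal.ofReal (puncturedWeight q (sites 0 l.1) z)]
        rfl
    _ ≤ passageWeight p y + ENNReal.ofReal (q - p) * ∑' z,
          (ENNReal.ofReal (Real.exp 1 * greenBound) * ∑' l : passageVisiting y z,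
            wordProb l.1.1 * ENNReal.ofReal (listWeight q (sites 0 l.1.1))) := by
        gcongr
        exact tsum_puncturedWeight_le hd hq0 hq y _
    _ = _ := by
        rw [ENNReal.tsum_mul_left, tsum_tsum_passageVisiting y fun z l =>
          wordProb l.1 * ENNReal.ofReal (listWeight q (sites 0 l.1))]
        congr 3
        refine tsum_congr fun l => ?_
        rw [Finset.sum_const, nsmul_eq_mul, ENNReal.ofReal_mul (Nat.cast_nonneg _),
          ENNReal.ofReal_natCast]
        ring

theorem natCast_mul_pow_le {ρ : ℝ} (h0 : 0 ≤ ρ) (h1 : ρ < 1) (m : ℕ) :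
    m * ρ ^ m ≤ 1 / (1 - ρ) := by
  calc m * ρ ^ m = ∑ _j ∈ Finset.range m, ρ ^ m := by simp
    _ ≤ ∑ j ∈ Finset.range m, ρ ^ j := Finset.sum_le_sum fun j hj =>
        pow_le_pow_of_le_one h0 h1.le (Finset.mem_range.1 hj).le
    _ ≤ ∑' j, ρ ^ j := (summable_geometric_of_lt_one h0 h1).sum_le_tsum _
        fun j _ => pow_nonneg h0 j
    _ = 1 / (1 - ρ) := by rw [tsum_geometric_of_lt_one h0 h1, one_div]

theorem natCast_mul_le_add {ρ w : ℝ} (h0 : 0 ≤ ρ) (h1 : ρ < 1) (hw0 : 0 ≤ w) {n : ℕ}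
    (hw : w ≤ ρ ^ n) (N : ℕ) : n * w ≤ N * w + 1 / (1 - ρ) * ρ ^ N := by
  have h2 : 0 ≤ 1 / (1 - ρ) * ρ ^ N :=
    mul_nonneg (one_div_pos.2 (by linarith)).le (pow_nonneg h0 N)
  rcases le_total n N with h | h
  · have : (n : ℝ) * w ≤ N * w := by gcongr
    linarith
  · obtain ⟨m, rfl⟩ := Nat.exists_eq_add_of_le h
    have : (m : ℝ) * w ≤ 1 / (1 - ρ) * ρ ^ N := by
      calc (m : ℝ) * w ≤ m * ρ ^ (N + m) := by gcongr
        _ = m * ρ ^ m * ρ ^ N := by ring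
        _ ≤ _ := mul_le_mul_of_nonneg_right (natCast_mul_pow_le h0 h1 m) (pow_nonneg h0 N)
    push_cast
    linarith

variable [NeZero d]

/-- Paths with at most `N` sites contribute at most `N` times the total weight. A path with `N + m`
sites has weight at most ρ^{N+m}, where ρ = φ_q(1), and mρ^m ≤ 1/(1-ρ) bounds the excess. -/
theorem tsum_card_le {q : ℝ} (hq0 : 0 ≤ q) (hq : q < 1) (y : Fin d → ℤ) (N : ℕ) :
    ∑' l : PassageWord y, wordProb l.1 *
        ENNReal.ofReal ((sites 0 l.1).toFinset.card * listWeight q (sites 0 l.1)) ≤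
      ENNReal.ofReal N * passageWeight q y +
        ENNReal.ofReal (1 / (1 - siteFactor q 1) * siteFactor q 1 ^ N) := by
  have hρ := siteFactor_one_lt_one hq
  have hρ0 := (siteFactor_pos hq0 1).le
  have h0 : 0 ≤ 1 / (1 - siteFactor q 1) * siteFactor q 1 ^ N :=
    mul_nonneg (one_div_pos.2 (by linarith)).le (pow_nonneg hρ0 N)
  calc ∑' l : PassageWord y, wordProb l.1 *
        ENNReal.ofReal ((sites 0 l.1).toFinset.card * listWeight q (sites 0 l.1))
      ≤ ∑' l : PassageWord y, (ENNReal.ofReal N *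
          (wordProb l.1 * ENNReal.ofReal (listWeight q (sites 0 l.1))) +
          wordProb l.1 * ENNReal.ofReal (1 / (1 - siteFactor q 1) * siteFactor q 1 ^ N)) := by
        refine ENNReal.tsum_le_tsum fun l => ?_
        have hw := (listWeight_pos hq0 (sites 0 l.1)).le
        rw [mul_left_comm, ← ENNReal.ofReal_mul (Nat.cast_nonneg N), ← mul_add,
          ← ENNReal.ofReal_add (mul_nonneg (Nat.cast_nonneg N) hw) h0]
        gcongr
        exact natCast_mul_le_add hρ0 hρ hw (listWeight_le_pow hq0 hq.le _) N
    _ ≤ _ := by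
        rw [ENNReal.tsum_add, ENNReal.tsum_mul_left, ENNReal.tsum_mul_right]
        gcongr
        · exact le_rfl
        · exact mul_le_of_le_one_left' (tsum_wordProb_firstPassage_le_one _ _)

end ParameterDependence

/-! ### Bounds for the cost at lattice points -/

section Cost

variable {d : ℕ}

/-- The annealed cost of a passage from the origin to `y` in terms of weights of paths. -/
def passageCost (r : ℝ) (y : Fin d → ℤ) : ℝ := -Real.log (passageWeight r y).toReal

theorem passageCost_neg (r : ℝ) (y : Fin d → ℤ) : passageCost r (-y) = passageCost r y := by
  rw [passageCost, passageCost, passageWeight_neg]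

variable [NeZero d]

theorem stepCost_pow_le_toReal {r : ℝ} (hr0 : 0 ≤ r) (hr1 : r ≤ 1) (y : Fin d → ℤ) :
    stepCost d ^ latticeNorm y ≤ (passageWeight r y).toReal :=
  (ENNReal.ofReal_le_iff_le_toReal (passageWeight_ne_top hr0 hr1 y)).1
    (stepCost_pow_le_passageWeight hr0 hr1 y)

theorem toReal_passageWeight_pos {r : ℝ} (hr0 : 0 ≤ r) (hr1 : r ≤ 1) (y : Fin d → ℤ) :
    0 < (passageWeight r y).toReal :=
  (pow_pos stepCost_pos _).trans_le (stepCost_pow_le_toReal hr0 hr1 y)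

theorem passageCost_add_le {r : ℝ} (hr0 : 0 ≤ r) (hr1 : r ≤ 1) (x y : Fin d → ℤ) :
    passageCost r (x + y) ≤ passageCost r x + passageCost r y := by
  have hx := toReal_passageWeight_pos hr0 hr1 x
  have hy := toReal_passageWeight_pos hr0 hr1 y
  rw [passageCost, passageCost, passageCost, ← neg_add, ← Real.log_mul hx.ne' hy.ne',
    ← ENNReal.toReal_mul]
  refine neg_le_neg (Real.log_le_log (by rw [ENNReal.toReal_mul]; positivity) ?_)
  exact ENNReal.toReal_mono (passageWeight_ne_top hr0 hr1 _) (passageWeight_mul_le hr0 hr1 x y)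

theorem passageCost_le {r : ℝ} (hr0 : 0 ≤ r) (hr1 : r ≤ 1) (y : Fin d → ℤ) :
    passageCost r y ≤ -Real.log (stepCost d) * latticeNorm y := by
  have := Real.log_le_log (pow_pos stepCost_pos _) (stepCost_pow_le_toReal hr0 hr1 y)
  rw [Real.log_pow] at this
  rw [passageCost]
  linarith

theorem le_passageCost {r : ℝ} (hr0 : 0 ≤ r) (hr1 : r ≤ 1) (y : Fin d → ℤ) :
    -Real.log (siteFactor r 1) * latticeNorm y ≤ passageCost r y := by
  have h := ENNReal.toReal_le_of_le_ofReal (pow_nonneg (siteFactor_pos hr0 _).le _)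
    (passageWeight_le_pow hr0 hr1 y)
  have := Real.log_le_log (toReal_passageWeight_pos hr0 hr1 y) h
  rw [Real.log_pow] at this
  rw [passageCost]
  linarith

theorem le_passageCost_sub {p q : ℝ} (hp : 0 ≤ p) (hpq : p ≤ q) (hq : q ≤ 1) (y : Fin d → ℤ) :
    (1 - Real.exp (-1)) * (q - p) * latticeNorm y ≤ passageCost p y - passageCost q y := by
  have hq0 := hp.trans hpq
  have h := ENNReal.toReal_mono (passageWeight_ne_top hq0 hq y)
    (passageWeight_exp_mul_le hp hpq hq y)
  rw [ENNReal.toReal_mul, ENNReal.toReal_ofReal (by positivity)] at h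
  have hz := toReal_passageWeight_pos hp (hpq.trans hq) y
  have := Real.log_le_log (by positivity) h
  rw [Real.log_mul (by positivity) hz.ne', Real.log_pow, Real.log_exp] at this
  rw [passageCost, passageCost]
  linarith

/-- Choose `K` for `q₀`; monotonicity of `siteFactor` in the parameter carries it to all smaller
`q`. Paths with at least `K * n` sites, `n` being the norm of the target, then carry at most half of
the guaranteed weight. -/
theorem exists_siteFactor_pow_le {q₀ : ℝ} (h1 : q₀ < 1) :
    ∃ K : ℕ, 0 < K ∧ ∀ q, 0 ≤ q → q ≤ q₀ → ∀ n : ℕ, n ≠ 0 →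
      siteFactor q 1 ^ (K * n) ≤ stepCost d ^ n / 2 := by
  have hc := stepCost_pos (d := d)
  obtain ⟨K, hK⟩ := exists_pow_lt_of_lt_one (half_pos hc) (siteFactor_one_lt_one h1)
  have hK0 : 0 < K := by
    rcases Nat.eq_zero_or_pos K with rfl | h
    · have := stepCost_lt_one (d := d)
      rw [pow_zero] at hK
      linarith
    · exact h
  refine ⟨K, hK0, fun q hq0 hq n hn => ?_⟩
  have hρ := (siteFactor_pos hq0 1).le
  calc siteFactor q 1 ^ (K * n) = (siteFactor q 1 ^ K) ^ n := pow_mul _ _ _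
    _ ≤ (stepCost d / 2) ^ n := by
        refine pow_le_pow_left₀ (pow_nonneg hρ _) (le_trans ?_ hK.le) n
        exact pow_le_pow_left₀ hρ (siteFactor_mono_param hq 1) K
    _ = stepCost d ^ n / 2 ^ n := div_pow _ _ _
    _ ≤ stepCost d ^ n / 2 := by
        gcongr
        exact le_self_pow₀ one_le_two hn

/-- With N = K|y|₁ the remainder is at most Z_q/2 and is absorbed on the left: Z_q ≤ 2(q/p)^N Z_p.
The term log 2 vanishes after rescaling. -/
theorem exists_passageCost_sub_le_log {q₀ : ℝ} (h1 : q₀ < 1) :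
    ∃ K : ℝ, 0 < K ∧ ∀ p q, 0 < p → p ≤ q → q ≤ q₀ → ∀ y : Fin d → ℤ, y ≠ 0 →
      passageCost p y - passageCost q y ≤
        Real.log 2 + K * (Real.log q - Real.log p) * latticeNorm y := by
  obtain ⟨K, hK0, hK⟩ := exists_siteFactor_pow_le (d := d) h1
  refine ⟨K, by exact_mod_cast hK0, fun p q hp hpq hq y hy => ?_⟩
  have hq0 := hp.trans_le hpq
  have hq1 : q ≤ 1 := hq.trans h1.le
  have hy' : latticeNorm y ≠ 0 := fun h => hy (latticeNorm_eq_zero.1 h)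
  have hz := toReal_passageWeight_pos hp.le (hpq.trans hq1) y
  have hzq := toReal_passageWeight_pos hq0.le hq1 y
  have h := passageWeight_le_div_pow_mul_add hp hpq hq1 y (K * latticeNorm y)
  have h2 := ENNReal.toReal_mono (ENNReal.add_ne_top.2 ⟨ENNReal.mul_ne_top ENNReal.ofReal_ne_top
    (passageWeight_ne_top hp.le (hpq.trans hq1) y), ENNReal.ofReal_ne_top⟩) h
  rw [ENNReal.toReal_add (ENNReal.mul_ne_top ENNReal.ofReal_ne_top
    (passageWeight_ne_top hp.le (hpq.trans hq1) y)) ENNReal.ofReal_ne_top, ENNReal.toReal_mul,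
    ENNReal.toReal_ofReal (by positivity),
    ENNReal.toReal_ofReal (pow_nonneg (siteFactor_pos hq0.le _).le _)] at h2
  have h3 := hK q hq0.le hq _ hy'
  have h4 := stepCost_pow_le_toReal hq0.le hq1 y
  have h5 : (passageWeight q y).toReal ≤
      2 * ((q / p) ^ (K * latticeNorm y) * (passageWeight p y).toReal) := by linarith
  have h6 := Real.log_le_log hzq h5
  rw [Real.log_mul two_ne_zero (by positivity), Real.log_mul (by positivity) hz.ne', Real.log_pow,
    Real.log_div hq0.ne' hp.ne'] at h6
  push_cast at h6
  rw [passageCost, passageCost]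
  linarith

theorem exp_neg_two_mul_le {x : ℝ} (h0 : 0 ≤ x) (h1 : x ≤ 1 / 2) :
    Real.exp (-(2 * x)) ≤ 1 - x := by
  have h2 : 0 < 1 - x := by linarith
  rw [Real.exp_neg, inv_le_comm₀ (Real.exp_pos _) h2]
  refine le_trans ?_ (Real.add_one_le_exp (2 * x))
  rw [inv_le_iff_one_le_mul₀ h2]
  nlinarith

/-- A function that decreases at most at a linear relative rate decreases at most
exponentially. -/
theorem le_exp_mul_of_local_bound {f : ℝ → ℝ} {p q T : ℝ} (hpq : p ≤ q) (hT : 0 ≤ T)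
    (hf0 : ∀ a, p ≤ a → a ≤ q → 0 ≤ f a)
    (hf : ∀ a b, p ≤ a → a ≤ b → b ≤ q → f b * (1 - T * (b - a)) ≤ f a) :
    f q ≤ Real.exp (2 * T * (q - p)) * f p := by
  -- The mesh (q-p)/n is so fine that T times it is at most 1/2, where 1 - x ≥ e^{-2x} applies.
  obtain ⟨n, hn⟩ := exists_nat_gt (2 * T * (q - p))
  have hqp : 0 ≤ q - p := sub_nonneg.2 hpq
  have hn0 : (0 : ℝ) < n := lt_of_le_of_lt (by positivity) hn
  set η := (q - p) / n with hη
  have hη0 : 0 ≤ η := by positivity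
  have hnη : n * η = q - p := by rw [hη]; field_simp
  have hTη : T * η ≤ 1 / 2 := by
    rw [hη, ← mul_div_assoc, div_le_iff₀ hn0]
    linarith
  have key : ∀ k : ℕ, k ≤ n → f (p + k * η) ≤ Real.exp (2 * (T * η)) ^ k * f p := by
    intro k
    induction k with
    | zero => simp
    | succ k ih =>
      intro hk
      have ih := ih (by omega)
      have hk' : ((k + 1 : ℕ) : ℝ) * η ≤ n * η := by gcongr
      have h1 := hf (p + k * η) (p + (k + 1 : ℕ) * η) (le_add_of_nonneg_right (by positivity))
        (by push_cast; linarith) (by linarith)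
      have h2 : p + (k + 1 : ℕ) * η - (p + k * η) = η := by push_cast; ring
      rw [h2] at h1
      have h3 := hf0 (p + (k + 1 : ℕ) * η) (le_add_of_nonneg_right (by positivity)) (by linarith)
      have h4 : f (p + (k + 1 : ℕ) * η) * Real.exp (-(2 * (T * η))) ≤ f (p + k * η) :=
        (mul_le_mul_of_nonneg_left (exp_neg_two_mul_le (by positivity) hTη) h3).trans h1
      rw [Real.exp_neg, ← div_eq_mul_inv, div_le_iff₀ (Real.exp_pos _)] at h4
      calc f (p + (k + 1 : ℕ) * η) ≤ f (p + k * η) * Real.exp (2 * (T * η)) := h4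
        _ ≤ Real.exp (2 * (T * η)) ^ k * f p * Real.exp (2 * (T * η)) := by gcongr
        _ = _ := by ring
  have := key n le_rfl
  rw [hnη, add_sub_cancel, ← Real.exp_nat_mul] at this
  rwa [show 2 * T * (q - p) = n * (2 * (T * η)) by rw [← hnη]; ring]

theorem greenBound_pos : 0 < greenBound := div_pos (by positivity) barrierGap_pos

/-- The weighted mean number of visited sites is at most (K+M)|y|₁, so Z_b(1 - T(b-a)) ≤ Z_a with T
= e · `greenBound` · (K+M)|y|₁. Chaining this over a fine partition of [p,q] doubles the constant
and leaves no additive error. -/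
theorem exists_passageCost_sub_le (hd : 3 ≤ d) {q₀ : ℝ} (h1 : q₀ < 1) :
    ∃ C : ℝ, 0 < C ∧ ∀ p q, 0 ≤ p → p ≤ q → q ≤ q₀ → ∀ y : Fin d → ℤ, y ≠ 0 →
      passageCost p y - passageCost q y ≤ C * (q - p) * latticeNorm y := by
  obtain ⟨K, hK0, hK⟩ := exists_siteFactor_pow_le (d := d) h1
  set M := 1 / (1 - siteFactor q₀ 1) with hMdef
  have hM : 0 < M := one_div_pos.2 (by linarith [siteFactor_one_lt_one h1])
  have hG := greenBound_pos
  have hKr : (0 : ℝ) < K := by exact_mod_cast hK0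
  refine ⟨2 * (Real.exp 1 * greenBound * (K + M)), by positivity,
    fun p q hp hpq hq y hy => ?_⟩
  have hy' : latticeNorm y ≠ 0 := fun h => hy (latticeNorm_eq_zero.1 h)
  have hy1 : (1 : ℝ) ≤ latticeNorm y := by exact_mod_cast Nat.one_le_iff_ne_zero.2 hy'
  have main : ∀ a b, p ≤ a → a ≤ b → b ≤ q →
      (passageWeight b y).toReal *
        (1 - Real.exp 1 * greenBound * (K + M) * latticeNorm y * (b - a)) ≤
      (passageWeight a y).toReal := by
    intro a b ha hab hb
    have ha0 := hp.trans ha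
    have hb0 := ha0.trans hab
    have hb1 : b < 1 := (hb.trans hq).trans_lt h1
    have hba : 0 ≤ b - a := sub_nonneg.2 hab
    set Z := (passageWeight b y).toReal with hZ
    have hZt := passageWeight_ne_top hb0 hb1.le y
    have hZ' : passageWeight b y = ENNReal.ofReal Z := (ENNReal.ofReal_toReal hZt).symm
    have hρ := siteFactor_one_lt_one hb1
    have hZ0 : 0 < Z := toReal_passageWeight_pos hb0 hb1.le y
    have hMb : 1 / (1 - siteFactor b 1) ≤ M := by
      rw [hMdef]
      have := siteFactor_one_lt_one h1
      have := siteFactor_mono_param (hb.trans hq) 1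
      gcongr
    have hpow : siteFactor b 1 ^ (K * latticeNorm y) ≤ Z := by
      have h2 := hK b hb0 (hb.trans hq) _ hy'
      have h3 := stepCost_pow_le_toReal hb0 hb1.le y
      have h4 : 0 < stepCost d ^ latticeNorm y := pow_pos stepCost_pos _
      linarith
    have hcard : ∑' l : PassageWord y, wordProb l.1 *
        ENNReal.ofReal ((sites 0 l.1).toFinset.card * listWeight b (sites 0 l.1)) ≤
        ENNReal.ofReal ((K + M) * latticeNorm y * Z) := by
      refine (tsum_card_le hb0 hb1 y (K * latticeNorm y)).trans ?_
      rw [hZ', ← ENNReal.ofReal_mul (Nat.cast_nonneg _), ← ENNReal.ofReal_add (by positivity)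
        (mul_nonneg (one_div_pos.2 (by linarith)).le (pow_nonneg (siteFactor_pos hb0 _).le _))]
      refine ENNReal.ofReal_le_ofReal ?_
      have h2 : 1 / (1 - siteFactor b 1) * siteFactor b 1 ^ (K * latticeNorm y) ≤ M * Z :=
        mul_le_mul hMb hpow (pow_nonneg (siteFactor_pos hb0 _).le _) hM.le
      have h3 : M * Z * 1 ≤ M * Z * latticeNorm y := by gcongr
      push_cast
      linarith
    have h2 : passageWeight b y ≤ passageWeight a y + ENNReal.ofReal (b - a) *
        (ENNReal.ofReal (Real.exp 1 * greenBound) *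
          ENNReal.ofReal ((K + M) * latticeNorm y * Z)) := by
      refine (passageWeight_le_add_tsum_card hd ha0 hab hb1.le y).trans ?_
      gcongr
    rw [← ENNReal.ofReal_mul (by positivity), ← ENNReal.ofReal_mul hba] at h2
    have h3 := ENNReal.toReal_mono (ENNReal.add_ne_top.2
      ⟨passageWeight_ne_top ha0 (hab.trans hb1.le) y, ENNReal.ofReal_ne_top⟩) h2
    rw [ENNReal.toReal_add (passageWeight_ne_top ha0 (hab.trans hb1.le) y) ENNReal.ofReal_ne_top,
      ENNReal.toReal_ofReal (by positivity)] at h3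
    linarith
  have hq1 : q ≤ 1 := hq.trans h1.le
  have h2 := le_exp_mul_of_local_bound (f := fun r => (passageWeight r y).toReal) hpq
    (by positivity) (fun a _ _ => ENNReal.toReal_nonneg) main
  have hz := toReal_passageWeight_pos hp (hpq.trans hq1) y
  have h3 := Real.log_le_log (toReal_passageWeight_pos (hp.trans hpq) hq1 y) h2
  rw [Real.log_mul (Real.exp_pos _).ne' hz.ne', Real.log_exp] at h3
  rw [passageCost, passageCost]
  linarith

end Cost

/-! ### The annealed cost as a sum over paths -/

section Representation

variable {d : ℕ}

/-- The trajectory of the walk started at `x` with increments given by the steps `ξ`. -/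
def walkPath (x : Fin d → ℤ) (ξ : ℕ → Fin d × Bool) (k : ℕ) : Fin d → ℤ :=
  x + ∑ i ∈ Finset.range k, unitStep (ξ i)

theorem endpoint_initialWord (x : Fin d → ℤ) (ξ : ℕ → Fin d × Bool) (n : ℕ) :
    endpoint x (initialWord ξ n) = walkPath x ξ n := by
  induction n with
  | zero => simp [initialWord, endpoint, walkPath]
  | succ n ih =>
    rw [initialWord_succ, endpoint_append, ih, walkPath, walkPath, Finset.sum_range_succ,
      ← add_assoc]
    rfl

theorem sites_initialWord (x : Fin d → ℤ) (ξ : ℕ → Fin d × Bool) (n : ℕ) :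
    sites x (initialWord ξ n) = (List.range n).map (walkPath x ξ) := by
  induction n with
  | zero => rfl
  | succ n ih =>
    rw [initialWord_succ, sites_append, ih, endpoint_initialWord, List.range_succ, List.map_append]
    rfl

theorem isFirstPassage_initialWord {x y : Fin d → ℤ} {ξ : ℕ → Fin d × Bool} {n : ℕ} :
    IsFirstPassage x y (initialWord ξ n) ↔
      walkPath x ξ n = y ∧ ∀ k < n, walkPath x ξ k ≠ y := by
  rw [IsFirstPassage, endpoint_initialWord, sites_initialWord]
  simp

theorem unitStep_injective : Function.Injective (unitStep (d := d)) := by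
  rintro ⟨i, a⟩ ⟨j, b⟩ h
  have hi := congrFun h i
  have hij : i = j := by
    by_contra hij
    simp only [unitStep, Pi.single_eq_same, Pi.single_eq_of_ne hij] at hi
    split_ifs at hi; omega
  subst hij
  simp only [unitStep, Pi.single_eq_same] at hi
  cases a <;> cases b <;> simp_all

/-- The steps are recovered from the increments. An embedding allows the change of variables without
a measurability check for the integrand. -/
theorem measurableEmbedding_walkPath (x : Fin d → ℤ) : MeasurableEmbedding (walkPath x) := by
  refine Measurable.measurableEmbedding ?_ ?_
  · refine measurable_pi_lambda _ fun k => measurable_const.add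
      (Finset.measurable_sum _ fun i _ => ?_)
    exact (measurable_of_finite unitStep).comp (measurable_pi_apply i)
  · intro ξ ξ' h
    funext k
    have h1 := congrFun h (k + 1)
    have h0 := congrFun h k
    simp only [walkPath, Finset.sum_range_succ] at h1 h0
    have h2 := add_left_cancel h0
    rw [h2] at h1
    exact unitStep_injective (add_left_cancel (add_left_cancel h1))

/-- The factor by which the potential weights a list of visited sites. -/
def potentialWeight (ω : (Fin d → ℤ) → ℝ≥0) (L : List (Fin d → ℤ)) : ℝ :=
  Real.exp (-(L.map fun z => (ω z : ℝ)).sum)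

/-- The integrand in the definition of `travelWeight`. -/
def pathWeight (y : Fin d → ℤ) (ω : (Fin d → ℤ) → ℝ≥0) (S : ℕ → Fin d → ℤ) : ℝ :=
  Set.indicator {S | hittingTime y S < ⊤}
    (fun S => Real.exp (-∑ k ∈ Finset.range (hittingTime y S).toNat, (ω (S k) : ℝ))) S

/-- At most one term is nonzero: a step sequence has exactly one first-passage word among its
initial words if the walk hits `y`, and none otherwise. -/
theorem ofReal_pathWeight_walkPath (x y : Fin d → ℤ) (ω : (Fin d → ℤ) → ℝ≥0)
    (ξ : ℕ → Fin d × Bool) :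
    ENNReal.ofReal (pathWeight y ω (walkPath x ξ)) =
      ∑' l : {l : List (Fin d × Bool) // IsFirstPassage x y l},
        (wordCylinder l.1).indicator
          (fun _ => ENNReal.ofReal (potentialWeight ω (sites x l.1))) ξ := by
  classical
  by_cases h : ∃ k, walkPath x ξ k = y
  · have hn := Nat.find_spec h
    have hmin : ∀ k < Nat.find h, walkPath x ξ k ≠ y := fun k hk => Nat.find_min h hk
    set n := Nat.find h
    have hT : hittingTime y (walkPath x ξ) = n := by
      refine le_antisymm (iInf₂_le n hn) (le_iInf₂ fun k hk => ?_)
      exact_mod_cast not_lt.1 fun hlt => hmin k hlt hk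
    have hfp : IsFirstPassage x y (initialWord ξ n) := isFirstPassage_initialWord.2 ⟨hn, hmin⟩
    rw [tsum_eq_single ⟨initialWord ξ n, hfp⟩]
    · rw [Set.indicator_of_mem (by simp [wordCylinder]), pathWeight, Set.indicator_of_mem
        (by simp [hT]), hT, potentialWeight, sites_initialWord]
      rw [List.map_map]
      rfl
    · intro l hl
      refine Set.indicator_of_notMem (fun hξ => hl (Subtype.ext ?_)) _
      rw [wordCylinder, Set.mem_ofPred_eq] at hξ
      have hl2 := l.2
      rw [← hξ] at hl2
      change l.1 = initialWord ξ n
      rw [← hξ]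
      rcases le_total l.1.length n with h' | h'
      · exact hl2.eq_of_prefix hfp (initialWord_prefix ξ h')
      · exact (hfp.eq_of_prefix hl2 (initialWord_prefix ξ h')).symm
  · have hT : hittingTime y (walkPath x ξ) = ⊤ := by
      simp only [hittingTime, iInf_eq_top]
      exact fun k hk => absurd ⟨k, hk⟩ h
    rw [pathWeight, Set.indicator_of_notMem (by simp [hT]), ENNReal.ofReal_zero]
    refine (ENNReal.tsum_eq_zero.2 fun l => Set.indicator_of_notMem (fun hξ => h ?_) _).symm
    rw [wordCylinder, Set.mem_ofPred_eq] at hξ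
    exact ⟨l.1.length, by rw [← endpoint_initialWord, hξ, l.2.1]⟩

/-- The travel weight as a sum over paths. -/
def quenchedWeight (x y : Fin d → ℤ) (ω : (Fin d → ℤ) → ℝ≥0) : ℝ≥0∞ :=
  ∑' l : {l : List (Fin d × Bool) // IsFirstPassage x y l},
    wordProb l.1 * ENNReal.ofReal (potentialWeight ω (sites x l.1))

theorem potentialWeight_le_one (ω : (Fin d → ℤ) → ℝ≥0) (L : List (Fin d → ℤ)) :
    potentialWeight ω L ≤ 1 := by
  refine Real.exp_le_one_iff.2 (neg_nonpos.2 (List.sum_nonneg fun a ha => ?_))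
  obtain ⟨z, -, rfl⟩ := List.mem_map.1 ha
  exact (ω z).2

theorem measurable_potentialWeight (L : List (Fin d → ℤ)) :
    Measurable fun ω : (Fin d → ℤ) → ℝ≥0 => potentialWeight ω L := by
  refine Real.measurable_exp.comp (Measurable.neg ?_)
  induction L with
  | nil => exact measurable_const
  | cons z L ih =>
    simp only [List.map_cons, List.sum_cons]
    exact (measurable_coe_nnreal_real.comp (measurable_pi_apply z)).add ih

theorem lintegral_exp_neg_bernoulliMeasure (r : unitInterval) (k : ℕ) :
    ∫⁻ a, ENNReal.ofReal (Real.exp (-(k * (a : ℝ)))) ∂(bernoulliMeasure (0 : ℝ≥0) 1 r) =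
      ENNReal.ofReal (siteFactor r k) := by
  rw [← ofReal_integral_eq_lintegral_ofReal (integrable_bernoulliMeasure _ _ _ _)
    (Filter.Eventually.of_forall fun a => (Real.exp_pos _).le), integral_bernoulliMeasure]
  simp [siteFactor]

/-- Grouping the visits by site turns the exponential into a product of functions of independent
variables. -/
theorem lintegral_potentialWeight (r : unitInterval) (L : List (Fin d → ℤ)) :
    ∫⁻ ω, ENNReal.ofReal (potentialWeight ω L) ∂(potentialLaw d r) =
      ENNReal.ofReal (listWeight r L) := by
  have hX : ∀ z : Fin d → ℤ, Measurable fun a : ℝ≥0 =>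
      ENNReal.ofReal (Real.exp (-((L.count z : ℝ) * (a : ℝ)))) := fun z => by fun_prop
  have hpw : ∀ ω : (Fin d → ℤ) → ℝ≥0, ENNReal.ofReal (potentialWeight ω L) =
      ∏ z ∈ L.toFinset, ENNReal.ofReal (Real.exp (-((L.count z : ℝ) * (ω z : ℝ)))) := by
    intro ω
    rw [← ENNReal.ofReal_prod_of_nonneg fun z _ => (Real.exp_pos _).le, ← Real.exp_sum,
      potentialWeight, Finset.sum_list_map_count, Finset.sum_neg_distrib]
    simp
  simp_rw [hpw]
  rw [potentialLaw, lintegral_prod_eq_prod_lintegral_of_indepFun L.toFinset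
    (fun z (ω : (Fin d → ℤ) → ℝ≥0) =>
      ENNReal.ofReal (Real.exp (-((L.count z : ℝ) * (ω z : ℝ)))))
    (iIndepFun_infinitePi hX) (fun z => (hX z).comp (measurable_pi_apply z)),
    listWeight, ENNReal.ofReal_prod_of_nonneg fun z _ => (siteFactor_pos r.2.1 _).le]
  refine Finset.prod_congr rfl fun z _ => ?_
  rw [← lintegral_exp_neg_bernoulliMeasure]
  exact (measurePreserving_eval_infinitePi
    (fun _ : Fin d → ℤ => bernoulliMeasure (0 : ℝ≥0) 1 r) z).lintegral_comp (hX z)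

variable [NeZero d]

theorem quenchedWeight_lt_top (x y : Fin d → ℤ) (ω : (Fin d → ℤ) → ℝ≥0) :
    quenchedWeight x y ω < ∞ := by
  refine lt_of_le_of_lt (le_trans (ENNReal.tsum_le_tsum fun l => ?_)
    (tsum_wordProb_firstPassage_le_one x y)) ENNReal.one_lt_top
  exact mul_le_of_le_one_right' (ENNReal.ofReal_le_one.2 (potentialWeight_le_one _ _))

theorem travelWeight_eq_toReal (x y : Fin d → ℤ) (ω : (Fin d → ℤ) → ℝ≥0) :
    travelWeight x y ω = (quenchedWeight x y ω).toReal := by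
  have hmeas : ∀ l : {l : List (Fin d × Bool) // IsFirstPassage x y l}, Measurable
      ((wordCylinder l.1).indicator
        (fun _ : ℕ → Fin d × Bool => ENNReal.ofReal (potentialWeight ω (sites x l.1)))) :=
    fun l => measurable_const.indicator (measurableSet_wordCylinder _)
  have h0 : ∀ S, 0 ≤ pathWeight y ω S := fun S =>
    Set.indicator_nonneg (fun _ _ => (Real.exp_pos _).le) S
  calc travelWeight x y ω
      = ∫ ξ, pathWeight y ω (walkPath x ξ)
          ∂(Measure.infinitePi fun _ : ℕ => uniformOn (Set.univ : Set (Fin d × Bool))) :=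
        (measurableEmbedding_walkPath x).integral_map _
    _ = ∫ ξ, (ENNReal.ofReal (pathWeight y ω (walkPath x ξ))).toReal
          ∂(Measure.infinitePi fun _ : ℕ => uniformOn (Set.univ : Set (Fin d × Bool))) := by
        simp_rw [ENNReal.toReal_ofReal (h0 _)]
    _ = _ := by
        simp_rw [ofReal_pathWeight_walkPath]
        rw [integral_toReal (Measurable.tsum hmeas).aemeasurable]
        · rw [lintegral_tsum fun l => (hmeas l).aemeasurable, quenchedWeight]
          congr 1
          refine tsum_congr fun l => ?_
          rw [lintegral_indicator (measurableSet_wordCylinder _), setLIntegral_const,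
            infinitePi_wordCylinder, mul_comm]
        · refine Filter.Eventually.of_forall fun ξ => ?_
          rw [← ofReal_pathWeight_walkPath]
          exact ENNReal.ofReal_lt_top

theorem integral_travelWeight (r : unitInterval) (y : Fin d → ℤ) :
    ∫ ω, travelWeight 0 y ω ∂(potentialLaw d r) = (passageWeight (r : ℝ) y).toReal := by
  have hmeas : ∀ l : {l : List (Fin d × Bool) // IsFirstPassage 0 y l}, Measurable
      fun ω : (Fin d → ℤ) → ℝ≥0 =>
        wordProb l.1 * ENNReal.ofReal (potentialWeight ω (sites 0 l.1)) :=
    fun l => (measurable_potentialWeight _).ennreal_ofReal.const_mul _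
  have hq : Measurable fun ω => quenchedWeight 0 y ω := Measurable.tsum hmeas
  simp_rw [travelWeight_eq_toReal]
  rw [integral_toReal hq.aemeasurable
    (Filter.Eventually.of_forall (quenchedWeight_lt_top 0 y))]
  simp_rw [quenchedWeight]
  rw [lintegral_tsum fun l => (hmeas l).aemeasurable, passageWeight]
  congr 1
  refine tsum_congr fun l => ?_
  rw [lintegral_const_mul _ (measurable_potentialWeight _).ennreal_ofReal,
    lintegral_potentialWeight]

theorem annealedCost_eq_passageCost (r : unitInterval) (y : Fin d → ℤ) :
    annealedCost r 0 y = passageCost (r : ℝ) y := by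
  rw [annealedCost, integral_travelWeight, passageCost]

end Representation

/-! ### From subadditive functions on the lattice to seminorms on `ℝ ^ d` -/

section Homogenization

variable {d : ℕ}

/-- The inclusion of the lattice in `ℝ ^ d`. -/
def latticeCast (x : Fin d → ℤ) : Fin d → ℝ := fun i => (x i : ℝ)

@[simp] theorem latticeCast_apply (x : Fin d → ℤ) (i : Fin d) : latticeCast x i = (x i : ℝ) := rfl

theorem latticeCast_add (x y : Fin d → ℤ) :
    latticeCast (x + y) = latticeCast x + latticeCast y := by
  ext i; simp

theorem latticeCast_sub (x y : Fin d → ℤ) :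
    latticeCast (x - y) = latticeCast x - latticeCast y := by
  ext i; simp

theorem latticeCast_neg (x : Fin d → ℤ) : latticeCast (-x) = -latticeCast x := by
  ext i; simp

theorem latticeCast_nsmul (n : ℕ) (x : Fin d → ℤ) :
    latticeCast (n • x) = (n : ℝ) • latticeCast x := by
  ext i; simp

theorem latticeCast_zero : latticeCast (0 : Fin d → ℤ) = 0 := by
  ext i; simp

variable (d) in
/-- The `ℓ¹`-norm as a seminorm. -/
def l1Seminorm : Seminorm ℝ (Fin d → ℝ) :=
  Seminorm.of l1Norm
    (fun v w => by
      rw [l1Norm, l1Norm, l1Norm, ← Finset.sum_add_distrib]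
      exact Finset.sum_le_sum fun i _ => abs_add_le _ _)
    (fun a v => by simp [l1Norm, abs_mul, Finset.mul_sum])

@[simp] theorem l1Seminorm_apply (v : Fin d → ℝ) : l1Seminorm d v = l1Norm v := rfl

theorem l1Norm_latticeCast (x : Fin d → ℤ) : l1Norm (latticeCast x) = latticeNorm x := by
  simp [l1Norm, latticeNorm, Nat.cast_natAbs]

theorem l1Norm_nonneg (v : Fin d → ℝ) : 0 ≤ l1Norm v := Finset.sum_nonneg fun _ _ => abs_nonneg _

theorem l1Norm_pos {v : Fin d → ℝ} (hv : v ≠ 0) : 0 < l1Norm v := by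
  obtain ⟨i, hi⟩ := Function.ne_iff.1 hv
  exact Finset.sum_pos' (fun _ _ => abs_nonneg _) ⟨i, Finset.mem_univ i, abs_pos.2 hi⟩

theorem le_of_forall_nat_mul_le_add {x y D : ℝ} (h : ∀ n : ℕ, 0 < n → n * x ≤ n * y + D) :
    x ≤ y := by
  by_contra! hlt
  obtain ⟨n, hn⟩ := exists_nat_gt (max (D / (x - y)) 1)
  have hxy : 0 < x - y := sub_pos.2 hlt
  have h1 : (1 : ℝ) < n := (le_max_right _ _).trans_lt hn
  have h2 := (le_max_left _ _).trans_lt hn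
  rw [div_lt_iff₀ hxy] at h2
  have h3 := h n (by exact_mod_cast (zero_lt_one.trans h1))
  linarith

theorem seminorm_le_sum (β : Seminorm ℝ (Fin d → ℝ)) (v : Fin d → ℝ) :
    β v ≤ ∑ i, |v i| * β (Pi.single i 1) := by
  calc β v = β (∑ i, v i • Pi.single i (1 : ℝ)) := by
        congr 1
        conv_lhs => rw [← Finset.univ_sum_single v]
        refine Finset.sum_congr rfl fun i _ => ?_
        rw [← Pi.single_smul, smul_eq_mul, mul_one]
    _ ≤ ∑ i, β (v i • Pi.single i (1 : ℝ)) :=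
        Finset.le_sum_of_subadditive β (map_zero β).le (map_add_le_add β) _ _
    _ = _ := Finset.sum_congr rfl fun i _ => by rw [map_smul_eq_mul, Real.norm_eq_abs]

/-- A seminorm is determined asymptotically by its values on the lattice. -/
theorem tendsto_seminorm_floor (β : Seminorm ℝ (Fin d → ℝ)) (v : Fin d → ℝ) :
    Tendsto (fun n : ℕ => β (latticeCast fun i => ⌊(n : ℝ) * v i⌋) / n) atTop (𝓝 (β v)) := by
  set D := ∑ i, β (Pi.single i (1 : ℝ)) with hD
  have h : ∀ n : ℕ, |β (latticeCast fun i => ⌊(n : ℝ) * v i⌋) - n * β v| ≤ D := by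
    intro n
    have h1 : (n : ℝ) * β v = β ((n : ℝ) • v) := by
      rw [map_smul_eq_mul, Real.norm_eq_abs, Nat.abs_cast]
    rw [h1]
    refine (abs_sub_map_le_sub β _ _).trans ((seminorm_le_sum β _).trans ?_)
    refine Finset.sum_le_sum fun i _ => mul_le_of_le_one_left (apply_nonneg β _) ?_
    simp only [Pi.sub_apply, latticeCast_apply, Pi.smul_apply, smul_eq_mul]
    rw [abs_sub_comm, Int.self_sub_floor, abs_of_nonneg (Int.fract_nonneg _)]
    exact (Int.fract_lt_one _).le
  rw [tendsto_iff_norm_sub_tendsto_zero]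
  refine squeeze_zero' (Eventually.of_forall fun _ => norm_nonneg _) ?_
    (tendsto_const_div_atTop_nhds_zero_nat D)
  filter_upwards [eventually_gt_atTop 0] with n hn
  have hn' : (0 : ℝ) < n := by exact_mod_cast hn
  rw [Real.norm_eq_abs, le_div_iff₀ hn']
  calc |β (latticeCast fun i => ⌊(n : ℝ) * v i⌋) / n - β v| * n
      = |β (latticeCast fun i => ⌊(n : ℝ) * v i⌋) - n * β v| := by
        conv_lhs => rw [← abs_of_pos hn', ← abs_mul]
        congr 1
        rw [abs_of_pos hn']
        field_simp
    _ ≤ D := h n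

/-- Approximate `v` by ⌊nv⌋/n. The sign of `κ` is free, so the lemma serves definiteness, uniqueness
(`κ = 0`) and both comparison bounds. -/
theorem mul_l1Norm_le_sub_of_lattice {κ : ℝ} {β₁ β₂ : Seminorm ℝ (Fin d → ℝ)}
    (h : ∀ x : Fin d → ℤ, κ * latticeNorm x ≤ β₁ (latticeCast x) - β₂ (latticeCast x))
    (v : Fin d → ℝ) : κ * l1Norm v ≤ β₁ v - β₂ v := by
  refine le_of_tendsto_of_tendsto' ((tendsto_seminorm_floor (l1Seminorm d) v).const_mul κ)
    ((tendsto_seminorm_floor β₁ v).sub (tendsto_seminorm_floor β₂ v)) fun n => ?_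
  rw [← mul_div_assoc, ← sub_div, l1Seminorm_apply, l1Norm_latticeCast]
  gcongr
  exact h _

section Extension

variable {b : (Fin d → ℤ) → ℝ} {C : ℝ}

/-- The greatest `C`-Lipschitz extension of a function on the lattice. -/
def lipschitzExtension (b : (Fin d → ℤ) → ℝ) (C : ℝ) (v : Fin d → ℝ) : ℝ :=
  ⨅ x : Fin d → ℤ, (b x + C * l1Norm (v - latticeCast x))

theorem lipschitzExtension_le (hb : ∀ x, 0 ≤ b x) (hC : 0 ≤ C) (v : Fin d → ℝ) (x : Fin d → ℤ) :
    lipschitzExtension b C v ≤ b x + C * l1Norm (v - latticeCast x) :=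
  ciInf_le ⟨0, by
    rintro _ ⟨x, rfl⟩
    exact add_nonneg (hb x) (mul_nonneg hC (l1Norm_nonneg _))⟩ x

theorem lipschitzExtension_nonneg (hb : ∀ x, 0 ≤ b x) (hC : 0 ≤ C) (v : Fin d → ℝ) :
    0 ≤ lipschitzExtension b C v :=
  le_ciInf fun x => add_nonneg (hb x) (mul_nonneg hC (l1Norm_nonneg _))

theorem lipschitzExtension_add_le (hb : ∀ x, 0 ≤ b x) (hC : 0 ≤ C)
    (hadd : ∀ x y, b (x + y) ≤ b x + b y) (v w : Fin d → ℝ) :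
    lipschitzExtension b C (v + w) ≤ lipschitzExtension b C v + lipschitzExtension b C w := by
  refine le_ciInf_add_ciInf fun x y => (lipschitzExtension_le hb hC _ (x + y)).trans ?_
  have h := map_add_le_add (l1Seminorm d) (v - latticeCast x) (w - latticeCast y)
  rw [show v - latticeCast x + (w - latticeCast y) = v + w - latticeCast (x + y) by
    rw [latticeCast_add]; abel] at h
  simp only [l1Seminorm_apply] at h
  nlinarith [hadd x y]

theorem lipschitzExtension_neg_le (hb : ∀ x, 0 ≤ b x) (hC : 0 ≤ C) (hneg : ∀ x, b (-x) = b x)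
    (v : Fin d → ℝ) : lipschitzExtension b C (-v) ≤ lipschitzExtension b C v := by
  refine le_ciInf fun x => (lipschitzExtension_le hb hC _ (-x)).trans_eq ?_
  have h := map_neg_eq_map (l1Seminorm d) (v - latticeCast x)
  simp only [l1Seminorm_apply] at h
  rw [hneg, latticeCast_neg, ← h, neg_sub, sub_neg_eq_add, neg_add_eq_sub]

/-- Subadditivity and linear growth make `b` itself `C`-Lipschitz for the ℓ¹-distance. -/
theorem lipschitzExtension_latticeCast (hb : ∀ x, 0 ≤ b x) (hC : 0 ≤ C)
    (hadd : ∀ x y, b (x + y) ≤ b x + b y) (hle : ∀ x, b x ≤ C * latticeNorm x) (x : Fin d → ℤ) :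
    lipschitzExtension b C (latticeCast x) = b x := by
  refine le_antisymm ((lipschitzExtension_le hb hC _ x).trans_eq ?_) (le_ciInf fun z => ?_)
  · simp [l1Norm]
  · have h1 := hadd z (x - z)
    have h2 := hle (x - z)
    rw [add_sub_cancel] at h1
    rw [← latticeCast_sub, l1Norm_latticeCast]
    linarith

/-- A nonnegative symmetric subadditive function on the lattice of at most linear growth has an
asymptotic seminorm. -/
theorem exists_seminorm_tendsto (hC : 0 ≤ C) (hb : ∀ x, 0 ≤ b x)
    (hadd : ∀ x y, b (x + y) ≤ b x + b y) (hneg : ∀ x, b (-x) = b x)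
    (hle : ∀ x, b x ≤ C * latticeNorm x) :
    ∃ β : Seminorm ℝ (Fin d → ℝ), ∀ x : Fin d → ℤ,
      Tendsto (fun n : ℕ => b (n • x) / n) atTop (𝓝 (β (latticeCast x))) := by
  set F := lipschitzExtension b C with hF
  have hF0 : ∀ v, 0 ≤ F v := lipschitzExtension_nonneg hb hC
  have hFadd : ∀ v w, F (v + w) ≤ F v + F w := lipschitzExtension_add_le hb hC hadd
  have hFneg : ∀ v, F (-v) ≤ F v := lipschitzExtension_neg_le hb hC hneg
  have hFx : ∀ x, F (latticeCast x) = b x := lipschitzExtension_latticeCast hb hC hadd hle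
  have hb0 : b 0 = 0 := le_antisymm (by simpa [latticeNorm] using hle 0) (hb 0)
  have hFle : ∀ v, F v ≤ C * l1Norm v := fun v => by
    simpa [hb0, latticeCast_zero] using lipschitzExtension_le hb hC v 0
  -- Since `F` is subadditive on all of `ℝ ^ d`, Fekete's lemma applies along every real direction,
  -- not only along lattice ones.
  have hlim : ∀ v : Fin d → ℝ, ∃ L, Tendsto (fun n : ℕ => F ((n : ℝ) • v) / n) atTop (𝓝 L) := by
    intro v
    have hsub : Subadditive fun n : ℕ => F ((n : ℝ) • v) := fun m n => by
      simpa [add_smul] using hFadd ((m : ℝ) • v) ((n : ℝ) • v)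
    refine ⟨_, hsub.tendsto_lim ⟨0, ?_⟩⟩
    rintro _ ⟨n, rfl⟩
    exact div_nonneg (hF0 _) (Nat.cast_nonneg n)
  choose β hβ using hlim
  have hβ0 : ∀ v, 0 ≤ β v := fun v =>
    ge_of_tendsto' (hβ v) fun n => div_nonneg (hF0 _) (Nat.cast_nonneg n)
  have hβadd : ∀ v w, β (v + w) ≤ β v + β w := fun v w =>
    le_of_tendsto_of_tendsto' (hβ (v + w)) ((hβ v).add (hβ w)) fun n => by
      rw [← add_div, smul_add]
      gcongr
      exact hFadd _ _
  have hβneg : ∀ v, β (-v) ≤ β v := fun v =>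
    le_of_tendsto_of_tendsto' (hβ (-v)) (hβ v) fun n => by
      rw [smul_neg]
      gcongr
      exact hFneg _
  have hβle : ∀ v, β v ≤ C * l1Norm v := fun v => by
    refine le_of_tendsto (hβ v) ?_
    filter_upwards [eventually_gt_atTop 0] with n hn
    have hn' : (0 : ℝ) < n := by exact_mod_cast hn
    rw [div_le_iff₀ hn']
    refine (hFle _).trans_eq ?_
    have := map_smul_eq_mul (l1Seminorm d) (n : ℝ) v
    simp only [l1Seminorm_apply, Real.norm_eq_abs, Nat.abs_cast] at this
    rw [this]
    ring
  have hβzero : β 0 = 0 := le_antisymm (by simpa [l1Norm] using hβle 0) (hβ0 0)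
  have hβnat : ∀ (m : ℕ) (v : Fin d → ℝ), β ((m : ℝ) • v) = m * β v := by
    intro m v
    rcases Nat.eq_zero_or_pos m with rfl | hm
    · simp [hβzero]
    · have hm' : (0 : ℝ) < m := by exact_mod_cast hm
      have h1 := ((hβ v).comp (tendsto_id.atTop_mul_const' hm)).const_mul (m : ℝ)
      refine tendsto_nhds_unique (hβ ((m : ℝ) • v)) (h1.congr fun n => ?_)
      simp only [Function.comp_apply, id_eq, Nat.cast_mul, smul_smul]
      field_simp
  -- Split na into its integer part and a remainder below one, whose contribution is bounded in `n`.
  -- The inequality suffices for `Seminorm.ofSMulLE`.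
  have hβpos : ∀ a : ℝ, 0 ≤ a → ∀ v, β (a • v) ≤ a * β v := by
    intro a ha v
    refine le_of_forall_nat_mul_le_add (D := C * l1Norm v) fun n _ => ?_
    have hna : 0 ≤ n * a := by positivity
    have e1 := Nat.floor_le hna
    have e2 := Nat.lt_floor_add_one (n * a)
    set k := ⌊n * a⌋₊
    have e3 : (n : ℝ) • a • v = (k : ℝ) • v + (n * a - k) • v := by
      rw [← add_smul, smul_smul]
      congr 1
      ring
    have e4 : l1Norm ((n * a - k) • v) ≤ l1Norm v := by
      have := map_smul_eq_mul (l1Seminorm d) (n * a - k) v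
      simp only [l1Seminorm_apply, Real.norm_eq_abs] at this
      rw [this, abs_of_nonneg (by linarith)]
      exact mul_le_of_le_one_left (l1Norm_nonneg v) (by linarith)
    calc (n : ℝ) * β (a • v) = β ((k : ℝ) • v + (n * a - k) • v) := by rw [← hβnat, e3]
      _ ≤ k * β v + C * l1Norm ((n * a - k) • v) := by
          rw [← hβnat]
          exact (hβadd _ _).trans (add_le_add le_rfl (hβle _))
      _ ≤ n * a * β v + C * l1Norm v := by
          have := hβ0 v
          gcongr
      _ = _ := by ring
  refine ⟨Seminorm.ofSMulLE β hβzero hβadd fun a v => ?_, fun x => ?_⟩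
  · rw [Real.norm_eq_abs]
    rcases le_total 0 a with ha | ha
    · rw [abs_of_nonneg ha]
      exact hβpos a ha v
    · rw [abs_of_nonpos ha]
      calc β (a • v) = β (-((-a) • v)) := by simp
        _ ≤ β ((-a) • v) := hβneg _
        _ ≤ -a * β v := hβpos _ (by linarith) v
  · refine (hβ (latticeCast x)).congr fun n => ?_
    rw [← latticeCast_nsmul, hFx]

end Extension

end Homogenization

/-! ### The Lyapunov exponent and transfer of the lattice bounds -/

section Exponent

variable {d : ℕ}

theorem IsAnnealedLyapunovExponent.tendsto_latticeCast {r : unitInterval}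
    {β : Seminorm ℝ (Fin d → ℝ)} (h : IsAnnealedLyapunovExponent d r β) (x : Fin d → ℤ) :
    Tendsto (fun n : ℕ => annealedCost r 0 (n • x) / (n : ℝ)) atTop (𝓝 (β (latticeCast x))) :=
  h.2 x

theorem IsAnnealedLyapunovExponent.unique {r : unitInterval} {β β' : Seminorm ℝ (Fin d → ℝ)}
    (h : IsAnnealedLyapunovExponent d r β) (h' : IsAnnealedLyapunovExponent d r β') : β = β' := by
  have heq : ∀ x, β (latticeCast x) = β' (latticeCast x) := fun x =>
    tendsto_nhds_unique (h.tendsto_latticeCast x) (h'.tendsto_latticeCast x)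
  ext v
  have h1 := mul_l1Norm_le_sub_of_lattice (κ := 0) (β₁ := β) (β₂ := β')
    (fun x => by rw [heq x]; simp) v
  have h2 := mul_l1Norm_le_sub_of_lattice (κ := 0) (β₁ := β') (β₂ := β)
    (fun x => by rw [heq x]; simp) v
  linarith

variable [NeZero d]

/-- Definiteness is where `r < 1` enters: then -log φ_r(1) > 0 is a lower bound for the cost per
unit of ℓ¹-distance. -/
theorem exists_isAnnealedLyapunovExponent {r : unitInterval} (hr : r < 1) :
    ∃ β : Seminorm ℝ (Fin d → ℝ), IsAnnealedLyapunovExponent d r β := by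
  have hr1 : (r : ℝ) < 1 := hr
  have hρ := siteFactor_one_lt_one hr1
  have hρ0 := siteFactor_pos r.2.1 1
  have hc : 0 < -Real.log (siteFactor (r : ℝ) 1) := neg_pos.2 (Real.log_neg hρ0 hρ)
  have hC : 0 ≤ -Real.log (stepCost d) :=
    neg_nonneg.2 (Real.log_nonpos stepCost_pos.le stepCost_lt_one.le)
  have hlow := le_passageCost (d := d) r.2.1 r.2.2
  obtain ⟨β, hβ⟩ := exists_seminorm_tendsto (d := d) (b := passageCost (r : ℝ)) hC
    (fun x => (mul_nonneg hc.le (Nat.cast_nonneg _)).trans (hlow x))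
    (passageCost_add_le r.2.1 r.2.2) (passageCost_neg (r : ℝ)) (passageCost_le r.2.1 r.2.2)
  refine ⟨β, fun v hv => ?_, fun x => ?_⟩
  · have h := mul_l1Norm_le_sub_of_lattice (κ := -Real.log (siteFactor (r : ℝ) 1)) (β₁ := β)
      (β₂ := 0) (fun x => ?_) v
    · by_contra hv0
      have h2 := mul_pos hc (l1Norm_pos hv0)
      rw [hv] at h
      simp only [zero_apply, sub_zero] at h
      linarith
    · have h0 : (0 : Seminorm ℝ (Fin d → ℝ)) (latticeCast x) = 0 := rfl
      rw [h0, sub_zero]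
      refine ge_of_tendsto (hβ x) ?_
      filter_upwards [eventually_gt_atTop 0] with n hn
      have hn' : (0 : ℝ) < n := by exact_mod_cast hn
      rw [le_div_iff₀ hn']
      refine le_trans (le_of_eq ?_) (hlow (n • x))
      rw [latticeNorm_nsmul]
      push_cast
      ring
  · simp only [annealedCost_eq_passageCost]
    exact hβ x

theorem isAnnealedLyapunovExponent {r : unitInterval} (hr : r < 1) :
    IsAnnealedLyapunovExponent d r (annealedLyapunovExponent d r) :=
  Classical.epsilon_spec (exists_isAnnealedLyapunovExponent hr)

theorem tendsto_passageCost_sub {p q : unitInterval} (hp : p < 1) (hq : q < 1) (x : Fin d → ℤ) :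
    Tendsto (fun n : ℕ => (passageCost (p : ℝ) (n • x) - passageCost (q : ℝ) (n • x)) / (n : ℝ))
      atTop (𝓝 (annealedLyapunovExponent d p (latticeCast x) -
        annealedLyapunovExponent d q (latticeCast x))) := by
  have h := ((isAnnealedLyapunovExponent hp).tendsto_latticeCast x).sub
    ((isAnnealedLyapunovExponent hq).tendsto_latticeCast x)
  simpa only [annealedCost_eq_passageCost, sub_div] using h

theorem le_annealedLyapunovExponent_sub {p q : unitInterval} (hp : p < 1) (hq : q < 1) {κ : ℝ}
    (h : ∀ y : Fin d → ℤ, κ * latticeNorm y ≤ passageCost (p : ℝ) y - passageCost (q : ℝ) y)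
    (v : Fin d → ℝ) :
    κ * l1Norm v ≤ annealedLyapunovExponent d p v - annealedLyapunovExponent d q v := by
  refine mul_l1Norm_le_sub_of_lattice (fun x => ?_) v
  refine ge_of_tendsto (tendsto_passageCost_sub hp hq x) ?_
  filter_upwards [eventually_gt_atTop 0] with n hn
  have hn' : (0 : ℝ) < n := by exact_mod_cast hn
  rw [le_div_iff₀ hn']
  refine le_trans (le_of_eq ?_) (h (n • x))
  rw [latticeNorm_nsmul]
  push_cast
  ring

/-- Along multiples `n • x` the additive constant contributes only `D / n`. -/
theorem annealedLyapunovExponent_sub_le {p q : unitInterval} (hp : p < 1) (hq : q < 1) {κ D : ℝ}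
    (h : ∀ y : Fin d → ℤ, y ≠ 0 →
      passageCost (p : ℝ) y - passageCost (q : ℝ) y ≤ D + κ * latticeNorm y)
    (v : Fin d → ℝ) :
    annealedLyapunovExponent d p v - annealedLyapunovExponent d q v ≤ κ * l1Norm v := by
  have hlat : ∀ x : Fin d → ℤ, annealedLyapunovExponent d p (latticeCast x) -
      annealedLyapunovExponent d q (latticeCast x) ≤ κ * latticeNorm x := by
    intro x
    by_cases hx : x = 0
    · subst hx
      simp [latticeCast_zero, latticeNorm]
    have hlim : Tendsto (fun n : ℕ => D / n + κ * latticeNorm x) atTop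
        (𝓝 (0 + κ * latticeNorm x)) :=
      (tendsto_const_div_atTop_nhds_zero_nat D).add_const _
    rw [zero_add] at hlim
    refine le_of_tendsto_of_tendsto (tendsto_passageCost_sub hp hq x) hlim ?_
    filter_upwards [eventually_gt_atTop 0] with n hn
    have hn' : (0 : ℝ) < n := by exact_mod_cast hn
    have h1 := h (n • x) (smul_ne_zero hn.ne' hx)
    rw [latticeNorm_nsmul] at h1
    push_cast at h1
    rw [div_le_iff₀ hn', add_mul, div_mul_cancel₀ _ hn'.ne']
    linarith
  have := mul_l1Norm_le_sub_of_lattice (κ := -κ) (β₁ := annealedLyapunovExponent d q)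
    (β₂ := annealedLyapunovExponent d p) (fun x => by linarith [hlat x]) v
  linarith

end Exponent

end BernoulliWalk

end

/-- The first conjunct says that the annealed Lyapunov exponents are well defined. The second one
is the lower bound, the third one the upper bound with its improvement in dimensions `d ≥ 3`. -/
theorem theorem1p2 (d : ℕ) (hd : 1 ≤ d) :
    (∀ r : unitInterval, 0 < r → r < 1 →
      ∃! β : Seminorm ℝ (Fin d → ℝ), BernoulliWalk.IsAnnealedLyapunovExponent d r β) ∧
    (∀ p q : unitInterval, 0 < p → p < q → q < 1 → ∀ x : Fin d → ℝ, x ≠ 0 →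
      (1 - Real.exp (-1)) * ((q : ℝ) - (p : ℝ)) ≤
        (BernoulliWalk.annealedLyapunovExponent d p x -
          BernoulliWalk.annealedLyapunovExponent d q x) / BernoulliWalk.l1Norm x) ∧
    (∀ q₀ : unitInterval, 0 < q₀ → q₀ < 1 →
      ∃ C : ℝ, 0 < C ∧ ∀ p q : unitInterval, 0 < p → p < q → q ≤ q₀ →
        ∀ x : Fin d → ℝ, x ≠ 0 →
          (BernoulliWalk.annealedLyapunovExponent d p x -
              BernoulliWalk.annealedLyapunovExponent d q x) / BernoulliWalk.l1Norm x ≤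
            C * (Real.log (q : ℝ) - Real.log (p : ℝ)) ∧
          (3 ≤ d →
            (BernoulliWalk.annealedLyapunovExponent d p x -
                BernoulliWalk.annealedLyapunovExponent d q x) / BernoulliWalk.l1Norm x ≤
              C * ((q : ℝ) - (p : ℝ)))) := by
  have : NeZero d := ⟨by omega⟩
  refine ⟨fun r _ hr1 => ?_, fun p q hp hpq hq x hx => ?_, fun q₀ _ hq₀ => ?_⟩
  · obtain ⟨β, hβ⟩ := BernoulliWalk.exists_isAnnealedLyapunovExponent (d := d) hr1
    exact ⟨β, hβ, fun β' hβ' => hβ'.unique hβ⟩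
  · rw [le_div_iff₀ (BernoulliWalk.l1Norm_pos hx)]
    exact BernoulliWalk.le_annealedLyapunovExponent_sub (hpq.trans hq) hq
      (BernoulliWalk.le_passageCost_sub p.2.1 (Subtype.coe_le_coe.2 hpq.le) q.2.2) x
  · have hq₀' : (q₀ : ℝ) < 1 := hq₀
    obtain ⟨K, hK0, hK⟩ := BernoulliWalk.exists_passageCost_sub_le_log (d := d) hq₀'
    -- The constant must be fixed before the dimension is distinguished; for `d < 3` the default 0
    -- is harmless, and `K + C` below serves both bounds.
    have hC : ∃ C : ℝ, 0 ≤ C ∧ (3 ≤ d → ∀ p q, 0 ≤ p → p ≤ q → q ≤ (q₀ : ℝ) →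
        ∀ y : Fin d → ℤ, y ≠ 0 → BernoulliWalk.passageCost p y - BernoulliWalk.passageCost q y ≤
          C * (q - p) * BernoulliWalk.latticeNorm y) := by
      by_cases hd3 : 3 ≤ d
      · obtain ⟨C, hC0, hC⟩ := BernoulliWalk.exists_passageCost_sub_le hd3 hq₀'
        exact ⟨C, hC0.le, fun _ => hC⟩
      · exact ⟨0, le_rfl, fun h => absurd h hd3⟩
    obtain ⟨C, hC0, hC⟩ := hC
    refine ⟨K + C, by linarith, fun p q hp hpq hq x hx => ?_⟩
    have hp0 : (0 : ℝ) < p := hp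
    have hpq' : (p : ℝ) ≤ q := Subtype.coe_le_coe.2 hpq.le
    have hq' : (q : ℝ) ≤ q₀ := Subtype.coe_le_coe.2 hq
    have hq1 : q < 1 := hq.trans_lt hq₀
    have hlog : 0 ≤ Real.log q - Real.log p := sub_nonneg.2 (Real.log_le_log hp0 hpq')
    have hl := BernoulliWalk.l1Norm_pos hx
    constructor
    · rw [div_le_iff₀ hl]
      refine (BernoulliWalk.annealedLyapunovExponent_sub_le (hpq.trans hq1) hq1
        (hK p q hp0 hpq' hq') x).trans ?_
      gcongr
      linarith
    · intro hd3
      rw [div_le_iff₀ hl]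
      refine (BernoulliWalk.annealedLyapunovExponent_sub_le (D := 0) (hpq.trans hq1) hq1
        (fun y hy => by rw [zero_add]; exact hC hd3 p q hp0.le hpq' hq' y hy) x).trans ?_
      have : 0 ≤ (q : ℝ) - p := sub_nonneg.2 hpq'
      gcongr
      linarith
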